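/- Let $\alpha\ge 0$ and let $1\ge\gamma_1\ge\gamma_2\ge\cdots>0$. For $h\in\mathbb Z^d$ put $r_\alpha(\gamma,h)=\prod_{j=1}^d r_\alpha(\gamma_j,h_j)$, where $r_\alpha(\gamma_j,0)=1$ and, for $k\neq0$, $r_\alpha(\gamma_j,k)=\gamma_j^{-1}|k|^{\alpha}$ if $\alpha>0$ and $r_\alpha(\gamma_j,k)=1$ if $\alpha=0$. Let $H_d$ be the weighted Korobov space of all complex-valued $f\in L_2([0,1]^d)$, periodic with period $1$ in each variable, with $$\|f\|_d=\Big(\sum_{h\in\mathbb Z^d} r_\alpha(\gamma,h)\,|\hat f(h)|^2\Big)^{1/2}<\infty,\qquad \hat f(h)=\int_{[0,1]^d}e^{-2\pi i h\cdot x}f(x)\,dx ,$$ and let $\mathrm{APP}_d:H_d\to L_2([0,1]^d)$, $\mathrm{APP}_df=f$. Let $\Lambda^{\rm all}=H_d^*$ be the class of all continuous linear functionals on $H_d$ and, for $\alpha>1$ (when every element of $H_d$ has a unique continuous representative), let $\Lambda^{\rm std}$ be the class of all function evaluations $f\mapsto f(x)$, $x\in[0,1]^d$. For $\Lambda\in\{\Lambda^{\rm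 all},\Lambda^{\rm std}\}$ let $\mathrm{comp}(\varepsilon,d,\Lambda)$ be the minimal $n$ for which there are $a_1,\dots,a_n\in L_2([0,1]^d)$ and $L_1,\dots,L_n\in\Lambda$ with $$\sup_{f\in H_d,\ \|f\|_d\le1}\Big\|f-\sum_{k=1}^n L_k(f)\,a_k\Big\|_{L_2([0,1]^d)}\le\varepsilon\,\|\mathrm{APP}_d\|$$ ($\mathrm{comp}=\infty$ if there is no such $n$). Approximation is tractable in the class $\Lambda$ if there are nonnegative numbers $C,p,q$ with $\mathrm{comp}(\varepsilon,d,\Lambda)\le C\varepsilon^{-p}d^{\,q}$ for all $\varepsilon\in(0,1)$ and $d=1,2,\dots$. It is strongly tractable if this holds with $q=0$; the infimum of the $p$ for which this is possible with $q=0$ is the exponent of strong tractability $p^*(\Lambda)$. Let $s_\gamma=\inf\{s>0:\sum_{j=1}^\infty\gamma_j^s<\infty\}$, with $\inf\emptyset=\infty$. 1. Let $\alpha\ge0$. Strong tractability and tractability in the class $\Lambda^{\rm all}$ are equivalent, and they hold if and only if $s_\gamma<\infty$ and $\alpha>0$. In this case $p^*(\Lambda^{\rm all})=2\max(s_\gamma,\alpha^{-1})$.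 2. Let $\alpha>1$. Strong tractability in the class $\Lambda^{\rm std}$ holds if and only if $\sum_{j=1}^\infty\gamma_j<\infty$. When this holds, $p^*(\Lambda^{\rm all})\le2$ and $p^*(\Lambda^{\rm std})\in[p^*(\Lambda^{\rm all}),\,p^*(\Lambda^{\rm all})+2]$. 3. Let $\alpha>1$. Tractability in the class $\Lambda^{\rm std}$ holds if and only if $$a:=\limsup_{d\to\infty}\frac{\sum_{j=1}^d\gamma_j}{\ln d}<\infty .$$ When this holds, for every $\delta>0$ there is a $C_\delta>0$ such that $$\mathrm{comp}(\varepsilon,d,\Lambda^{\rm std})\le C_\delta\,\varepsilon^{-(2+\delta)}\,d^{\,4\zeta(\alpha)a+\delta}\qquad\text{for all } d=1,2,\dots \text{ and all } \varepsilon\in(0,1),$$ where $\zeta$ is the Riemann zeta function. -/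

import Mathlib

open MeasureTheory Filter Topology
open scoped ENNReal NNReal

noncomputable section

namespace Korobov

/-- Lebesgue measure on `[0,1]^d`, seen as the torus `(ℝ/ℤ)^d`: the product of the translation
invariant probability measures of the circles `ℝ/ℤ`. -/
abbrev cubeMeasure (d : ℕ) : Measure (UnitAddTorus (Fin d)) :=
  Measure.pi fun _ : Fin d => (AddCircle.haarAddCircle : Measure UnitAddCircle)

/-- The space `L₂([0,1]^d)` of square integrable complex-valued functions that are periodic with
period one in each variable, i.e. of functions on the torus `(ℝ/ℤ)^d`. -/
abbrev L2 (d : ℕ) : Type :=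
  Lp ℂ 2 (cubeMeasure d)

/-- The one-dimensional factor `r_α(g, k)`: it is `1` for `k = 0`, and `g^{-s} |k|^α` for `k ≠ 0`,
where `s = 1` if `α > 0` and `s = 0` if `α = 0`. -/
def r1 (α g : ℝ) (k : ℤ) : ℝ :=
  if k = 0 then 1 else (if 0 < α then g⁻¹ else 1) * |(k : ℝ)| ^ α

/-- `r_α(γ, h) = ∏_{j ≤ d} r_α(γ_j, h_j)`. The sequence of weights is indexed from zero:
`γ 0, γ 1, …` are the weights of the first, second, … variable. -/
def r (α : ℝ) (γ : ℕ → ℝ) {d : ℕ} (h : Fin d → ℤ) : ℝ :=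
  ∏ j : Fin d, r1 α (γ j) (h j)

/-- The Fourier coefficient `∫_{[0,1]^d} exp(-2π i h·x) f(x) dx`. -/
def coeff {d : ℕ} (f : L2 d) (h : Fin d → ℤ) : ℂ :=
  UnitAddTorus.mFourierCoeff (f : UnitAddTorus (Fin d) → ℂ) h

theorem coeff_eq_repr {d : ℕ} (f : L2 d) (h : Fin d → ℤ) :
    coeff f h = UnitAddTorus.mFourierBasis.repr f h :=
  (UnitAddTorus.mFourierBasis_repr f h).symm

theorem coeff_zero {d : ℕ} (h : Fin d → ℤ) : coeff (0 : L2 d) h = 0 := by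
  simp [coeff_eq_repr]

theorem coeff_add {d : ℕ} (f g : L2 d) (h : Fin d → ℤ) :
    coeff (f + g) h = coeff f h + coeff g h := by
  simp [coeff_eq_repr]

theorem coeff_smul {d : ℕ} (c : ℂ) (f : L2 d) (h : Fin d → ℤ) :
    coeff (c • f) h = c * coeff f h := by
  simp [coeff_eq_repr]

theorem summable_r_add {d : ℕ} {w : (Fin d → ℤ) → ℝ} {u v : (Fin d → ℤ) → ℂ}
    (hu : Summable fun h => |w h| * ‖u h‖ ^ 2) (hv : Summable fun h => |w h| * ‖v h‖ ^ 2) :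
    Summable fun h => |w h| * ‖u h + v h‖ ^ 2 := by
  refine Summable.of_nonneg_of_le (fun h => by positivity) (fun h => ?_)
    ((hu.mul_left 2).add (hv.mul_left 2))
  have h1 : ‖u h + v h‖ ^ 2 ≤ 2 * ‖u h‖ ^ 2 + 2 * ‖v h‖ ^ 2 := by
    have := norm_add_le (u h) (v h)
    nlinarith [sq_nonneg (‖u h‖ - ‖v h‖), norm_nonneg (u h + v h)]
  nlinarith [mul_le_mul_of_nonneg_left h1 (abs_nonneg (w h))]

theorem summable_iff_abs {d : ℕ} (w : (Fin d → ℤ) → ℝ) (u : (Fin d → ℤ) → ℂ) :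
    (Summable fun h => w h * ‖u h‖ ^ 2) ↔ Summable fun h => |w h| * ‖u h‖ ^ 2 := by
  rw [← summable_abs_iff]
  simp [abs_mul]

/-- The weighted Korobov space `H_d`: all `f ∈ L₂([0,1]^d)` with
`∑_h r_α(γ, h) |f̂(h)|² < ∞`. -/
def H (α : ℝ) (γ : ℕ → ℝ) (d : ℕ) : Submodule ℂ (L2 d) where
  carrier := {f | Summable fun h : Fin d → ℤ => r α γ h * ‖coeff f h‖ ^ 2}
  zero_mem' := by
    simp only [Set.mem_ofPred_eq, coeff_zero]
    simp [summable_zero]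
  add_mem' := by
    intro f g hf hg
    simp only [Set.mem_ofPred_eq, coeff_add] at hf hg ⊢
    rw [summable_iff_abs] at hf hg ⊢
    exact summable_r_add hf hg
  smul_mem' := by
    intro c f hf
    simp only [Set.mem_ofPred_eq, coeff_smul] at hf ⊢
    refine (hf.mul_left (‖c‖ ^ 2)).congr fun h => ?_
    rw [norm_mul]
    ring

/-- The Korobov norm `‖f‖_d = (∑_h r_α(γ, h) |f̂(h)|²)^{1/2}` on `H_d`. -/
def normH {α : ℝ} {γ : ℕ → ℝ} {d : ℕ} (f : H α γ d) : ℝ :=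
  Real.sqrt (∑' h : Fin d → ℤ, r α γ h * ‖coeff (f : L2 d) h‖ ^ 2)

/-- The class `Λ^all = H_d^*` of all linear functionals on `H_d` that are continuous, i.e.
bounded, with respect to the Korobov norm. -/
def LambdaAll (α : ℝ) (γ : ℕ → ℝ) (d : ℕ) : Set (H α γ d →ₗ[ℂ] ℂ) :=
  {L | ∃ C : ℝ, ∀ f : H α γ d, ‖L f‖ ≤ C * normH f}

/-- The class `Λ^std` (for `α > 1`) of all function evaluations `L_x(f) = f(x)`. An element of
`H_d`, `α > 1`, is a class modulo equality almost everywhere that has exactly one continuous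
representative, and `f(x)` is the value of that representative. -/
def LambdaStd (α : ℝ) (γ : ℕ → ℝ) (d : ℕ) : Set (H α γ d →ₗ[ℂ] ℂ) :=
  {L | ∃ x : UnitAddTorus (Fin d), ∀ (f : H α γ d) (g : C(UnitAddTorus (Fin d), ℂ)),
    ((f : L2 d) : UnitAddTorus (Fin d) → ℂ) =ᵐ[cubeMeasure d] g → L f = g x}

/-- The linear algorithm `A_{n,d}(f) = ∑_{k ≤ n} L_k(f) a_k`. -/
def algorithm {α : ℝ} {γ : ℕ → ℝ} {d n : ℕ} (a : Fin n → L2 d)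
    (L : Fin n → (H α γ d →ₗ[ℂ] ℂ)) (f : H α γ d) : L2 d :=
  ∑ k : Fin n, L k f • a k

/-- The worst case error `sup { ‖f - A(f)‖_{L₂} : f ∈ H_d, ‖f‖_d ≤ 1 }`. -/
def worstCaseError {α : ℝ} {γ : ℕ → ℝ} {d : ℕ} (A : H α γ d → L2 d) : ℝ≥0∞ :=
  ⨆ (f : H α γ d) (_ : normH f ≤ 1), ‖(f : L2 d) - A f‖ₑ

/-- The norm `sup { ‖f‖_{L₂} : f ∈ H_d, ‖f‖_d ≤ 1 }` of the embedding
`APP_d : H_d → L₂([0,1]^d)`. -/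
def normAPP (α : ℝ) (γ : ℕ → ℝ) (d : ℕ) : ℝ≥0∞ :=
  ⨆ (f : H α γ d) (_ : normH f ≤ 1), ‖(f : L2 d)‖ₑ

/-- A class of information: for every dimension a set of linear functionals on `H_d`. -/
abbrev InfoClass (α : ℝ) (γ : ℕ → ℝ) : Type :=
  ∀ d : ℕ, Set (H α γ d →ₗ[ℂ] ℂ)

/-- `comp^wor(ε, H_d, Λ)`: the minimal `n` for which some algorithm that uses `n` functionals
from `Λ` has worst case error at most `ε ‖APP_d‖` (it is `⊤` if there is no such `n`). -/
def comp {α : ℝ} {γ : ℕ → ℝ} (Λ : InfoClass α γ) (ε : ℝ) (d : ℕ) : ℕ∞ :=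
  ⨅ (n : ℕ) (_ : ∃ (a : Fin n → L2 d) (L : Fin n → (H α γ d →ₗ[ℂ] ℂ)),
    (∀ k, L k ∈ Λ d) ∧
      worstCaseError (algorithm a L) ≤ ENNReal.ofReal ε * normAPP α γ d), (n : ℕ∞)

/-- `comp^wor(ε, H_d, Λ) ≤ C ε^{-p} d^q` for all `ε ∈ (0,1)` and all `d = 1, 2, …`. -/
def CompBound {α : ℝ} {γ : ℕ → ℝ} (Λ : InfoClass α γ) (C p q : ℝ) : Prop :=
  ∀ ε : ℝ, 0 < ε → ε < 1 → ∀ d : ℕ, 1 ≤ d →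
    (comp Λ ε d : ℝ≥0∞) ≤ ENNReal.ofReal (C * ε ^ (-p) * (d : ℝ) ^ q)

/-- Tractability of approximation in the class `Λ`. -/
def Tractable {α : ℝ} {γ : ℕ → ℝ} (Λ : InfoClass α γ) : Prop :=
  ∃ C p q : ℝ, 0 ≤ C ∧ 0 ≤ p ∧ 0 ≤ q ∧ CompBound Λ C p q

/-- Strong tractability of approximation in the class `Λ`: the bound holds with `q = 0`. -/
def StronglyTractable {α : ℝ} {γ : ℕ → ℝ} (Λ : InfoClass α γ) : Prop :=
  ∃ C p : ℝ, 0 ≤ C ∧ 0 ≤ p ∧ CompBound Λ C p 0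

/-- The exponent of strong tractability `p^*(Λ)`: the infimum of all `p ≥ 0` for which the bound
with `q = 0` holds for some `C ≥ 0` (it is `∞` if there is no such `p`). -/
def exponent {α : ℝ} {γ : ℕ → ℝ} (Λ : InfoClass α γ) : ℝ≥0∞ :=
  ⨅ (p : ℝ≥0) (_ : ∃ C : ℝ, 0 ≤ C ∧ CompBound Λ C p 0), (p : ℝ≥0∞)

/-- The sum-exponent `s_γ = inf { s > 0 : ∑_j γ_j^s < ∞ }`, with `inf ∅ = ∞`. -/
def sumExponent (γ : ℕ → ℝ) : ℝ≥0∞ :=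
  ⨅ (s : ℝ≥0) (_ : 0 < s ∧ Summable fun j : ℕ => γ j ^ (s : ℝ)), (s : ℝ≥0∞)

/-- `a = limsup_{d → ∞} (∑_{j ≤ d} γ_j) / ln d`, an element of `[0, ∞]`. -/
def logRatio (γ : ℕ → ℝ) : ℝ≥0∞ :=
  limsup (fun d : ℕ => ENNReal.ofReal ((∑ j ∈ Finset.range d, γ j) / Real.log d)) atTop

end Korobov

end

noncomputable section

namespace Korobov

variable {α : ℝ} {γ : ℕ → ℝ} {d : ℕ}

/-! ### The weights -/

/-! In Fourier coordinates the embedding is diagonal with singular values `r ^ (-1/2)`, and its norm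
is 1, so everything reduces to counting frequencies of small weight and, for function values, to
controlling aliasing.

All functionals. Truncating the Fourier series to `r ≤ ε⁻²` has error at most `ε`. For `αs > 1` the
number of these frequencies is at most `ε ^ (-2s) ∏ (1 + 2 γ_j^s ζ(αs))`, and the product is bounded
in `d` once `∑ γ_j^s` converges (`compBound_all`). Conversely, fewer functionals than frequencies
with `r < ε⁻²` share a nonzero zero among the trigonometric polynomials on these frequencies
(`card_le_comp`). Frequencies `1, …, N` in one variable then force `αp ≥ 2`, and 0-1 frequencies
with `k` ones force a power decay of `γ_d` (`CompBound.pow_weight_le`), which bounds `s_γ`. Both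
lower bounds hold for every information class.

Function values, necessity. The kernel with Fourier coefficients `1/r` dominates `|q|²` for a
product `q` of two-term polynomials. A trace against Hilbert-Schmidt estimate for operators of rank
`n` (`norm_sum_mul_norm_sq_sq_le`) then yields a function vanishing at `n` given points, with mean
equal to its squared norm and at least `1 - n / q(0)²` (`exists_fooling`). Since `q(0)² ≥ exp (∑ γ_j
/ 3)`, a complexity bound at `ε = 1/2` bounds `∑_{j ≤ d} γ_j` by a constant or by a multiple of `ln
d`.

Function values, sufficiency. Fourier coefficients are computed by rank-one lattice rules with `p`
points. With `T = ∑ 1/r`, the mean over generators of the alias sum of a fixed low frequency is at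
most `3T/p`, so for `p ≥ 6MT` at least half of the generators serve it. About `log₂` of the number
of low frequencies many lattices therefore serve all of them, and the cost is nearly linear in `ε⁻²
T` (`comp_std_le`, `exists_comp_std_le`). As `T ≤ exp (2 ζ(α) ∑ γ_j)`, it is bounded for summable
weights and polynomial in `d` when the sums grow like `ln d`. -/

theorem one_le_r1 (hα : 0 ≤ α) {g : ℝ} (hg : 0 < g) (hg1 : g ≤ 1) (k : ℤ) : 1 ≤ r1 α g k := by
  unfold r1
  split_ifs with hk h
  · exact le_rfl
  all_goals
    have hk1 : (1 : ℝ) ≤ |(k : ℝ)| := by exact_mod_cast Int.one_le_abs hk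
    have := Real.one_le_rpow hk1 hα
  · exact one_le_mul_of_one_le_of_one_le ((one_le_inv₀ hg).2 hg1) this
  · simpa using this

theorem r1_le {g : ℝ} (hg : 0 < g) (hg1 : g ≤ 1) {k : ℤ} (hk : k ≠ 0) :
    r1 α g k ≤ g⁻¹ * |(k : ℝ)| ^ α := by
  unfold r1
  rw [if_neg hk]
  gcongr
  split_ifs
  · exact le_rfl
  · exact (one_le_inv₀ hg).2 hg1

theorem r1_of_pos (hα : 0 < α) {g : ℝ} {k : ℤ} (hk : k ≠ 0) :
    r1 α g k = g⁻¹ * |(k : ℝ)| ^ α := by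
  simp [r1, hk, hα]

@[simp] theorem r1_zero {g : ℝ} : r1 α g 0 = 1 := by simp [r1]

theorem one_le_r (hα : 0 ≤ α) (hγ : ∀ j, 0 < γ j ∧ γ j ≤ 1) (h : Fin d → ℤ) : 1 ≤ r α γ h := by
  rw [r, ← Finset.prod_const_one (s := Finset.univ (α := Fin d))]
  exact Finset.prod_le_prod (fun _ _ => zero_le_one) fun j _ => one_le_r1 hα (hγ j).1 (hγ j).2 _

theorem r_pos (hα : 0 ≤ α) (hγ : ∀ j, 0 < γ j ∧ γ j ≤ 1) (h : Fin d → ℤ) : 0 < r α γ h :=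
  zero_lt_one.trans_le (one_le_r hα hγ h)

@[simp] theorem r_zero : r α γ (0 : Fin d → ℤ) = 1 := by simp [r]

/-! ### Parseval's identity and trigonometric polynomials -/

theorem hasSum_norm_sq (f : L2 d) : HasSum (fun h => ‖coeff f h‖ ^ 2) (‖f‖ ^ 2) := by
  have h1 := UnitAddTorus.mFourierBasis.repr.norm_map f
  have h2 := lp.hasSum_norm (p := 2) (by norm_num) (UnitAddTorus.mFourierBasis.repr f)
  simp only [ENNReal.toReal_ofNat, Real.rpow_ofNat] at h2
  rw [h1] at h2
  simpa only [coeff_eq_repr] using h2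

theorem mem_H {f : L2 d} : f ∈ H α γ d ↔ Summable fun h => r α γ h * ‖coeff f h‖ ^ 2 := Iff.rfl

theorem normH_nonneg (f : H α γ d) : 0 ≤ normH f := Real.sqrt_nonneg _

theorem normH_sq (hα : 0 ≤ α) (hγ : ∀ j, 0 < γ j ∧ γ j ≤ 1) (f : H α γ d) :
    normH f ^ 2 = ∑' h, r α γ h * ‖coeff (f : L2 d) h‖ ^ 2 :=
  Real.sq_sqrt (tsum_nonneg fun h => mul_nonneg (r_pos hα hγ h).le (sq_nonneg _))

theorem hasSum_normH_sq (hα : 0 ≤ α) (hγ : ∀ j, 0 < γ j ∧ γ j ≤ 1) (f : H α γ d) :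
    HasSum (fun h => r α γ h * ‖coeff (f : L2 d) h‖ ^ 2) (normH f ^ 2) := by
  rw [normH_sq hα hγ]
  exact (mem_H.1 f.2).hasSum

theorem norm_le_normH (hα : 0 ≤ α) (hγ : ∀ j, 0 < γ j ∧ γ j ≤ 1) (f : H α γ d) :
    ‖(f : L2 d)‖ ≤ normH f := by
  refine (pow_le_pow_iff_left₀ (norm_nonneg _) (normH_nonneg f) two_ne_zero).1 ?_
  refine hasSum_le (fun h => ?_) (hasSum_norm_sq (f : L2 d)) (hasSum_normH_sq hα hγ f)
  exact le_mul_of_one_le_left (sq_nonneg _) (one_le_r hα hγ h)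

/-- Taking one Fourier coefficient, as a linear functional on `L₂`. -/
def coeffₗ (h : Fin d → ℤ) : L2 d →ₗ[ℂ] ℂ where
  toFun f := coeff f h
  map_add' f g := coeff_add f g h
  map_smul' c f := coeff_smul c f h

theorem coeff_sum {ι : Type*} (s : Finset ι) (f : ι → L2 d) (h : Fin d → ℤ) :
    coeff (∑ i ∈ s, f i) h = ∑ i ∈ s, coeff (f i) h :=
  map_sum (coeffₗ h) f s

theorem coeff_sub (f g : L2 d) (h : Fin d → ℤ) : coeff (f - g) h = coeff f h - coeff g h :=
  map_sub (coeffₗ h) f g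

/-- The trigonometric monomial of frequency `h` in `L₂`. -/
def monomial (h : Fin d → ℤ) : L2 d := UnitAddTorus.mFourierBasis h

theorem coeff_monomial (k h : Fin d → ℤ) : coeff (monomial k) h = if h = k then 1 else 0 := by
  classical
  rw [coeff_eq_repr, monomial, HilbertBasis.repr_self, lp.coeFn_single, Pi.single_apply]

/-- The trigonometric polynomial with coefficients `c` on the finite set `B`. -/
def trigPoly (B : Finset (Fin d → ℤ)) (c : (Fin d → ℤ) → ℂ) : L2 d := ∑ h ∈ B, c h • monomial h

theorem coeff_trigPoly (B : Finset (Fin d → ℤ)) (c : (Fin d → ℤ) → ℂ) (h : Fin d → ℤ) :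
    coeff (trigPoly B c) h = if h ∈ B then c h else 0 := by
  simp [trigPoly, coeff_sum, coeff_smul, coeff_monomial]

theorem trigPoly_mem_H (B : Finset (Fin d → ℤ)) (c : (Fin d → ℤ) → ℂ) :
    trigPoly B c ∈ H α γ d := by
  rw [mem_H]
  refine summable_of_hasFiniteSupport (B.finite_toSet.subset fun h hh => ?_)
  by_contra hB
  exact hh (by simp [coeff_trigPoly, show h ∉ B from hB])

theorem norm_sq_trigPoly (B : Finset (Fin d → ℤ)) (c : (Fin d → ℤ) → ℂ) :
    ‖trigPoly B c‖ ^ 2 = ∑ h ∈ B, ‖c h‖ ^ 2 := by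
  refine (hasSum_norm_sq _).unique ?_
  have : ∀ h ∈ B, ‖c h‖ ^ 2 = ‖coeff (trigPoly B c) h‖ ^ 2 := fun h hh => by
    simp [coeff_trigPoly, hh]
  rw [Finset.sum_congr rfl this]
  exact hasSum_sum_of_ne_finset_zero fun h hh => by simp [coeff_trigPoly, hh]

theorem normH_sq_trigPoly (hα : 0 ≤ α) (hγ : ∀ j, 0 < γ j ∧ γ j ≤ 1)
    (B : Finset (Fin d → ℤ)) (c : (Fin d → ℤ) → ℂ) :
    normH (⟨trigPoly B c, trigPoly_mem_H B c⟩ : H α γ d) ^ 2 = ∑ h ∈ B, r α γ h * ‖c h‖ ^ 2 := by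
  refine (hasSum_normH_sq hα hγ _).unique ?_
  have : ∀ h ∈ B, r α γ h * ‖c h‖ ^ 2 = r α γ h * ‖coeff (trigPoly B c) h‖ ^ 2 := fun h hh => by
    simp [coeff_trigPoly, hh]
  rw [Finset.sum_congr rfl this]
  exact hasSum_sum_of_ne_finset_zero fun h hh => by simp [coeff_trigPoly, hh]

/-! ### Worst case errors and information complexity -/

theorem normH_smul (hα : 0 ≤ α) (hγ : ∀ j, 0 < γ j ∧ γ j ≤ 1) (c : ℂ) (f : H α γ d) :
    normH (c • f) = ‖c‖ * normH f := by
  refine (pow_left_inj₀ (normH_nonneg _) (by positivity [normH_nonneg f]) two_ne_zero).1 ?_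
  rw [mul_pow]
  refine (hasSum_normH_sq hα hγ _).unique (((hasSum_normH_sq hα hγ f).mul_left (‖c‖ ^ 2)).congr_fun
    fun h => ?_)
  simp only [SetLike.val_smul, coeff_smul, norm_mul]
  ring

/-- All weights are at least 1, and the constant function 1 attains the supremum because the zero
frequency has weight 1. The normalised error criterion is thus the absolute one. -/
theorem normAPP_eq_one (hα : 0 ≤ α) (hγ : ∀ j, 0 < γ j ∧ γ j ≤ 1) : normAPP α γ d = 1 := by
  refine le_antisymm (iSup₂_le fun f hf => ?_) ?_
  · rw [← ofReal_norm]
    exact ENNReal.ofReal_le_one.2 ((norm_le_normH hα hγ f).trans hf)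
  · have h1 := normH_sq_trigPoly hα hγ {(0 : Fin d → ℤ)} 1
    have h2 := norm_sq_trigPoly {(0 : Fin d → ℤ)} 1
    simp only [Finset.sum_singleton, r_zero, Pi.one_apply, norm_one, one_pow, mul_one] at h1 h2
    rw [pow_eq_one_iff_of_nonneg (normH_nonneg _) two_ne_zero] at h1
    rw [pow_eq_one_iff_of_nonneg (norm_nonneg _) two_ne_zero] at h2
    refine le_iSup₂_of_le _ h1.le ?_
    rw [← ofReal_norm, h2, ENNReal.ofReal_one]

theorem comp_le (hα : 0 ≤ α) (hγ : ∀ j, 0 < γ j ∧ γ j ≤ 1) {Λ : InfoClass α γ} {ε : ℝ}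
    {ι : Type*} [Fintype ι] (a : ι → L2 d) (L : ι → (H α γ d →ₗ[ℂ] ℂ)) (hL : ∀ k, L k ∈ Λ d)
    (hA : ∀ f : H α γ d, normH f ≤ 1 → ‖(f : L2 d) - ∑ k, L k f • a k‖ ≤ ε) :
    comp Λ ε d ≤ Fintype.card ι := by
  let e := (Fintype.equivFin ι).symm
  refine iInf₂_le (Fintype.card ι) ⟨fun k => a (e k), fun k => L (e k), fun k => hL _, ?_⟩
  rw [normAPP_eq_one hα hγ, mul_one]
  refine iSup₂_le fun f hf => ?_
  rw [← ofReal_norm]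
  refine ENNReal.ofReal_le_ofReal ?_
  rw [algorithm, e.sum_comp fun k => L k f • a k]
  exact hA f hf

/-- A linear algorithm returns 0 on a common zero of its functionals, so such a function, rescaled
to the unit ball, is itself the error. -/
theorem le_comp (hα : 0 ≤ α) (hγ : ∀ j, 0 < γ j ∧ γ j ≤ 1) {Λ : InfoClass α γ} {ε : ℝ}
    (hε : 0 ≤ ε) {N : ℕ}
    (hN : ∀ n < N, ∀ L : Fin n → (H α γ d →ₗ[ℂ] ℂ), (∀ k, L k ∈ Λ d) →
      ∃ f : H α γ d, (∀ k, L k f = 0) ∧ ε * normH f < ‖(f : L2 d)‖) :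
    (N : ℕ∞) ≤ comp Λ ε d := by
  refine le_iInf₂ fun n ⟨a, L, hL, hw⟩ => ?_
  by_contra! hlt
  obtain ⟨f, hf0, hf⟩ := hN n (by exact_mod_cast hlt) L hL
  rw [normAPP_eq_one hα hγ, mul_one] at hw
  have hpos : 0 < normH f := (norm_pos_iff.2 fun h0 => by
    rw [h0, norm_zero] at hf
    exact absurd hf (not_lt.2 (mul_nonneg hε (normH_nonneg f)))).trans_le (norm_le_normH hα hγ f)
  set g : H α γ d := ((normH f)⁻¹ : ℂ) • f with hg
  have hg1 : normH g ≤ 1 := by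
    rw [hg, normH_smul hα hγ, norm_inv, Complex.norm_real, Real.norm_of_nonneg hpos.le,
      inv_mul_cancel₀ hpos.ne']
  have h1 : ‖(g : L2 d) - algorithm a L g‖ₑ ≤ ENNReal.ofReal ε :=
    (le_iSup₂ (f := fun (f : H α γ d) (_ : normH f ≤ 1) => ‖(f : L2 d) - algorithm a L f‖ₑ)
      g hg1).trans hw
  have h2 : algorithm a L g = 0 := by simp [algorithm, hg, hf0]
  rw [h2, sub_zero, ← ofReal_norm, ENNReal.ofReal_le_ofReal_iff hε, hg,
    SetLike.val_smul, norm_smul, norm_inv, Complex.norm_real, Real.norm_of_nonneg hpos.le,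
    inv_mul_le_iff₀ hpos] at h1
  linarith

/-! ### Sums of negative powers of the weights -/

theorem hasSum_fin_prod {d : ℕ} {f : Fin d → ℤ → ℝ} {a : Fin d → ℝ} (hf : ∀ j k, 0 ≤ f j k)
    (ha : ∀ j, HasSum (f j) (a j)) :
    HasSum (fun h : Fin d → ℤ => ∏ j, f j (h j)) (∏ j, a j) := by
  induction d with
  | zero =>
    have := hasSum_unique fun h : Fin 0 → ℤ => ∏ j, f j (h j)
    rwa [Fin.prod_univ_zero] at this ⊢
  | succ d ih =>
    have ih := ih (fun j k => hf j.succ k) fun j => ha j.succ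
    rw [← (Fin.consEquiv fun _ : Fin (d + 1) => ℤ).hasSum_iff, Fin.prod_univ_succ]
    have hs := (ha 0).summable.mul_of_nonneg ih.summable (fun k => hf 0 k)
      fun h => Finset.prod_nonneg fun j _ => hf _ _
    refine ((ha 0).mul ih hs).congr_fun fun p => ?_
    simp [Fin.prod_univ_succ, Fin.consEquiv]

/-- The real zeta series `∑_{n ≥ 1} n^{-t}`. -/
def zetaSum (t : ℝ) : ℝ := ∑' n : ℕ, ((n : ℝ) + 1) ^ (-t)

theorem hasSum_zetaSum {t : ℝ} (ht : 1 < t) :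
    HasSum (fun n : ℕ => ((n : ℝ) + 1) ^ (-t)) (zetaSum t) := by
  have := (summable_nat_add_iff 1).2 (Real.summable_nat_rpow.2 (neg_lt_neg ht))
  simp only [Nat.cast_add, Nat.cast_one] at this
  exact this.hasSum

theorem one_le_zetaSum {t : ℝ} (ht : 1 < t) : 1 ≤ zetaSum t := by
  have := sum_le_hasSum (Finset.range 1) (fun n _ => by positivity) (hasSum_zetaSum ht)
  simpa using this

theorem zetaSum_eq_riemannZeta {t : ℝ} (ht : 1 < t) : zetaSum t = (riemannZeta (t : ℂ)).re := by
  rw [zeta_eq_tsum_one_div_nat_add_one_cpow (by simpa using ht)]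
  have : ∀ n : ℕ, 1 / ((n : ℂ) + 1) ^ (t : ℂ) = ((((n : ℝ) + 1) ^ (-t) : ℝ) : ℂ) := fun n => by
    rw [Complex.ofReal_cpow (by positivity), one_div, ← Complex.cpow_neg]
    push_cast
    rfl
  simp_rw [this]
  rw [← Complex.ofReal_tsum, Complex.ofReal_re, zetaSum]

theorem hasSum_r1_rpow (hα : 0 < α) {s : ℝ} (hs : 1 < α * s) {g : ℝ} (hg : 0 < g) :
    HasSum (fun k : ℤ => r1 α g k ^ (-s)) (1 + 2 * g ^ s * zetaSum (α * s)) := by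
  have hval : ∀ k : ℤ, k ≠ 0 → r1 α g k ^ (-s) = g ^ s * |(k : ℝ)| ^ (-(α * s)) := fun k hk => by
    rw [r1_of_pos hα hk, Real.mul_rpow (by positivity) (by positivity), ← Real.rpow_mul (abs_nonneg _),
      Real.inv_rpow hg.le, Real.rpow_neg hg.le, inv_inv, mul_neg]
  have h0 : r1 α g 0 ^ (-s) = 1 := by rw [r1_zero, Real.one_rpow]
  obtain ⟨F, hF⟩ : ∃ F : ℤ → ℝ, F = fun k => r1 α g k ^ (-s) := ⟨_, rfl⟩
  replace hval : ∀ k : ℤ, k ≠ 0 → F k = g ^ s * |(k : ℝ)| ^ (-(α * s)) := by simpa only [hF]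
  replace h0 : F 0 = 1 := by simp only [hF, h0]
  rw [← hF]
  have h := (hasSum_zetaSum hs).mul_left (g ^ s)
  have h1 : HasSum (fun n : ℕ => F n) (1 + g ^ s * zetaSum (α * s)) := by
    rw [← hasSum_nat_add_iff' 1]
    rw [Finset.sum_range_one, Nat.cast_zero, h0, add_sub_cancel_left]
    refine h.congr_fun fun n => ?_
    rw [hval _ (by omega), Int.cast_natCast, abs_of_nonneg (Nat.cast_nonneg _), Nat.cast_succ]
  have h2 : HasSum (fun n : ℕ => F (-((n : ℤ) + 1))) (g ^ s * zetaSum (α * s)) := by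
    refine h.congr_fun fun n => ?_
    rw [hval _ (by omega), Int.cast_neg, abs_neg, Int.cast_add, Int.cast_one, Int.cast_natCast,
      abs_of_nonneg (by positivity)]
  rw [two_mul, add_mul, ← add_assoc]
  exact h1.of_nat_of_neg_add_one h2

theorem hasSum_r_rpow (hα : 0 < α) (hγ : ∀ j, 0 < γ j ∧ γ j ≤ 1) {s : ℝ} (hs : 1 < α * s) :
    HasSum (fun h : Fin d → ℤ => r α γ h ^ (-s))
      (∏ j : Fin d, (1 + 2 * γ j ^ s * zetaSum (α * s))) := by
  have hpos : ∀ (j : Fin d) (k : ℤ), 0 ≤ r1 α (γ j) k := fun j k =>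
    zero_le_one.trans (one_le_r1 hα.le (hγ j).1 (hγ j).2 k)
  refine (hasSum_fin_prod (fun j k => Real.rpow_nonneg (hpos j k) _)
    fun j => hasSum_r1_rpow hα hs (hγ j).1).congr_fun fun h => ?_
  rw [r, Real.finsetProd_rpow _ _ fun j _ => hpos j _]

/-- The inequality `1 + x ≤ exp x` in each factor; it converts hypotheses on sums of weights into
bounds uniform or polynomial in `d`. -/
theorem prod_le_exp_sum {c : ℝ} (hc : 0 ≤ c) (u : ℕ → ℝ) (hu : ∀ j, 0 ≤ u j) (d : ℕ) :
    ∏ j : Fin d, (1 + 2 * u j * c) ≤ Real.exp (2 * c * ∑ j ∈ Finset.range d, u j) := by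
  rw [Finset.mul_sum, Real.exp_sum, ← Fin.prod_univ_eq_prod_range]
  refine Finset.prod_le_prod (fun j _ => by have := hu j; positivity) fun j _ => ?_
  calc 1 + 2 * u j * c = 2 * c * u j + 1 := by ring
    _ ≤ _ := Real.add_one_le_exp _

theorem finite_setOf_r_le (hα : 0 < α) (hγ : ∀ j, 0 < γ j ∧ γ j ≤ 1) {M : ℝ} :
    {h : Fin d → ℤ | r α γ h ≤ M}.Finite := by
  -- Any exponent above `1/α` would do: convergence of `∑ r ^ (-s)` makes `r` tend to infinity along
  -- the frequencies.
  have hs : 1 < α * (2 / α) := by field_simp; norm_num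
  by_cases hM : 0 < M
  · have := (hasSum_r_rpow (d := d) hα hγ hs).summable.tendsto_cofinite_zero.eventually
      (gt_mem_nhds (show 0 < M ^ (-(2 / α)) by positivity))
    refine (Filter.eventually_cofinite.1 this).subset fun h hh => ?_
    exact not_lt.2 (Real.rpow_le_rpow_of_nonpos (r_pos hα.le hγ h) hh
      (neg_nonpos.2 (by positivity)))
  · refine Set.finite_empty.subset fun h hh => hM ((r_pos hα.le hγ h).trans_le hh)

/-- The set of all frequencies of weight at most `M`. -/
def lowFreq (hα : 0 < α) (hγ : ∀ j, 0 < γ j ∧ γ j ≤ 1) (d : ℕ) (M : ℝ) : Finset (Fin d → ℤ) :=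
  (finite_setOf_r_le hα hγ (M := M)).toFinset

theorem mem_lowFreq {hα : 0 < α} {hγ : ∀ j, 0 < γ j ∧ γ j ≤ 1} {M : ℝ} {h : Fin d → ℤ} :
    h ∈ lowFreq hα hγ d M ↔ r α γ h ≤ M := by simp [lowFreq]

/-- Every counted frequency contributes at least `M ^ (-s)` to the convergent series `∑ r ^ (-s)`.
-/
theorem card_lowFreq_le (hα : 0 < α) (hγ : ∀ j, 0 < γ j ∧ γ j ≤ 1) {s : ℝ} (hs : 1 < α * s)
    {M : ℝ} (hM : 0 < M) :
    ((lowFreq hα hγ d M).card : ℝ) ≤ M ^ s * ∏ j : Fin d, (1 + 2 * γ j ^ s * zetaSum (α * s)) := by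
  have hs0 : 0 < s := by
    by_contra! h0
    nlinarith
  have h1 := sum_le_hasSum (lowFreq hα hγ d M)
    (fun h _ => Real.rpow_nonneg (r_pos hα.le hγ h).le _) (hasSum_r_rpow (d := d) hα hγ hs)
  have h2 : (lowFreq hα hγ d M).card • M ^ (-s) ≤ ∑ h ∈ lowFreq hα hγ d M, r α γ h ^ (-s) :=
    Finset.card_nsmul_le_sum _ _ _ fun h hh => Real.rpow_le_rpow_of_nonpos (r_pos hα.le hγ h)
      (mem_lowFreq.1 hh) (neg_nonpos.2 hs0.le)
  have h3 := h2.trans h1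
  rw [nsmul_eq_mul, Real.rpow_neg hM.le, ← div_eq_mul_inv, div_le_iff₀ (by positivity)] at h3
  linarith

/-! ### Arbitrary continuous functionals: upper bounds -/

/-- The Fourier coefficient at the frequency `h` as a functional on the Korobov space. -/
def coeffFunctional (h : Fin d → ℤ) : H α γ d →ₗ[ℂ] ℂ := (coeffₗ h).comp (H α γ d).subtype

theorem coeffFunctional_mem (hα : 0 ≤ α) (hγ : ∀ j, 0 < γ j ∧ γ j ≤ 1) (h : Fin d → ℤ) :
    (coeffFunctional h : H α γ d →ₗ[ℂ] ℂ) ∈ LambdaAll α γ d := by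
  refine ⟨1, fun f => ?_⟩
  rw [one_mul]
  refine le_trans ?_ (norm_le_normH hα hγ f)
  refine (pow_le_pow_iff_left₀ (norm_nonneg _) (norm_nonneg _) two_ne_zero).1 ?_
  exact le_hasSum (hasSum_norm_sq (f : L2 d)) h fun _ _ => sq_nonneg _

/-- The squared distance of `f` to a trigonometric polynomial on the low frequencies. -/
theorem norm_sub_trigPoly_sq_le (hα : 0 < α) (hγ : ∀ j, 0 < γ j ∧ γ j ≤ 1) {M : ℝ} (hM : 0 < M)
    (f : H α γ d) (c : (Fin d → ℤ) → ℂ) :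
    ‖(f : L2 d) - trigPoly (lowFreq hα hγ d M) c‖ ^ 2 ≤ M⁻¹ * normH f ^ 2 +
      ∑ h ∈ lowFreq hα hγ d M, ‖coeff (f : L2 d) h - c h‖ ^ 2 := by
  have h1 : HasSum (fun h => if h ∈ lowFreq hα hγ d M then ‖coeff (f : L2 d) h - c h‖ ^ 2 else 0)
      (∑ h ∈ lowFreq hα hγ d M, ‖coeff (f : L2 d) h - c h‖ ^ 2) := by
    rw [← Finset.sum_congr rfl fun h hh => if_pos hh]
    exact hasSum_sum_of_ne_finset_zero fun h hh => if_neg hh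
  refine hasSum_le (fun h => ?_) (hasSum_norm_sq _)
    (((hasSum_normH_sq hα.le hγ f).mul_left M⁻¹).add h1)
  have hr := r_pos hα.le hγ h
  rw [coeff_sub, coeff_trigPoly]
  split_ifs with hh
  · have : 0 ≤ M⁻¹ * (r α γ h * ‖coeff (f : L2 d) h‖ ^ 2) := by positivity
    linarith
  -- Off the low frequencies `r > M`, so the tail is paid for by the Korobov norm.
  · rw [sub_zero, add_zero, ← mul_assoc]
    refine le_mul_of_one_le_left (sq_nonneg _) ?_
    rw [mem_lowFreq, not_le] at hh
    rw [inv_mul_eq_div, one_le_div hM]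
    exact hh.le

theorem comp_all_le (hα : 0 < α) (hγ : ∀ j, 0 < γ j ∧ γ j ≤ 1) {ε : ℝ} (hε : 0 < ε) :
    comp (LambdaAll α γ) ε d ≤ (lowFreq hα hγ d (ε ^ (-2 : ℝ))).card := by
  rw [← Fintype.card_coe]
  refine comp_le hα.le hγ (fun h => monomial h.1) (fun h => coeffFunctional h.1)
    (fun h => coeffFunctional_mem hα.le hγ _) fun f hf => ?_
  have h1 := norm_sub_trigPoly_sq_le hα hγ (M := ε ^ (-2 : ℝ)) (by positivity) f
    fun h => coeff (f : L2 d) h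
  simp only [sub_self, norm_zero, ne_eq, OfNat.ofNat_ne_zero, not_false_eq_true, zero_pow,
    Finset.sum_const_zero, add_zero] at h1
  rw [← Real.rpow_neg hε.le, neg_neg, Real.rpow_two, ← mul_pow] at h1
  have h2 := (pow_le_pow_iff_left₀ (norm_nonneg _) (by have := normH_nonneg f; positivity)
    two_ne_zero).1 h1
  rw [trigPoly, ← Finset.sum_coe_sort] at h2
  exact h2.trans (mul_le_of_le_one_right hε.le hf)

theorem compBound_of_forall {Λ : InfoClass α γ} {C p q : ℝ}
    (h : ∀ ε : ℝ, 0 < ε → ε < 1 → ∀ d : ℕ, 1 ≤ d → ∃ N : ℕ, comp Λ ε d ≤ N ∧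
      (N : ℝ) ≤ C * ε ^ (-p) * (d : ℝ) ^ q) : CompBound Λ C p q := fun ε h0 h1 d hd => by
  obtain ⟨N, hN, hNle⟩ := h ε h0 h1 d hd
  calc (comp Λ ε d : ℝ≥0∞) ≤ ((N : ℕ∞) : ℝ≥0∞) := by exact_mod_cast hN
    _ = ENNReal.ofReal N := by simp
    _ ≤ _ := ENNReal.ofReal_le_ofReal hNle

theorem compBound_all (hα : 0 < α) (hγ : ∀ j, 0 < γ j ∧ γ j ≤ 1) {s : ℝ} (hs : 1 < α * s)
    (hsum : Summable fun j => γ j ^ s) :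
    ∃ C : ℝ, 0 ≤ C ∧ CompBound (LambdaAll α γ) C (2 * s) 0 := by
  have hZ : 0 ≤ zetaSum (α * s) := zero_le_one.trans (one_le_zetaSum hs)
  refine ⟨Real.exp (2 * zetaSum (α * s) * ∑' j, γ j ^ s), (Real.exp_pos _).le,
    compBound_of_forall fun ε hε0 hε1 d hd => ⟨_, comp_all_le hα hγ hε0, ?_⟩⟩
  have hnn : ∀ j, 0 ≤ γ j ^ s := fun j => Real.rpow_nonneg (hγ j).1.le _
  refine (card_lowFreq_le hα hγ hs (by positivity)).trans ?_
  rw [Real.rpow_zero, mul_one, ← Real.rpow_mul hε0.le, mul_comm, neg_mul]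
  gcongr
  refine (prod_le_exp_sum hZ _ hnn d).trans ?_
  gcongr
  exact hsum.sum_le_tsum _ fun j _ => hnn j

/-! ### Lower bounds for arbitrary information -/

/-- With `n < A.card` functionals, the `n × A` matrix of their values on monomials has a nontrivial
kernel. A kernel vector gives a trigonometric polynomial on `A`, on which `r < ε⁻²` makes the `L₂`
norm exceed `ε` times the Korobov norm. -/
theorem card_le_comp (hα : 0 ≤ α) (hγ : ∀ j, 0 < γ j ∧ γ j ≤ 1) {Λ : InfoClass α γ} {ε : ℝ}
    (hε : 0 < ε) (A : Finset (Fin d → ℤ)) (hA : ∀ h ∈ A, r α γ h < ε ^ (-2 : ℝ)) :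
    (A.card : ℕ∞) ≤ comp Λ ε d := by
  refine le_comp hα hγ hε.le fun n hn L _ => ?_
  let m : (Fin d → ℤ) → H α γ d := fun h => ⟨trigPoly {h} 1, trigPoly_mem_H _ _⟩
  let φ := (Matrix.of fun (k : Fin n) (h : A) => L k (m h.1)).mulVecLin
  have hker : LinearMap.ker φ ≠ ⊥ := LinearMap.ker_ne_bot_of_finrank_lt (by simpa using hn)
  obtain ⟨c, hc, hc0⟩ := (Submodule.ne_bot_iff _).1 hker
  let c' : (Fin d → ℤ) → ℂ := fun h => if hh : h ∈ A then c ⟨h, hh⟩ else 0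
  have hc' : ∀ h : A, c' h.1 = c h := fun h => by simp [c']
  let f : H α γ d := ⟨trigPoly A c', trigPoly_mem_H _ _⟩
  have hf : f = ∑ h : A, c h • m h.1 := by
    ext1
    simp only [f, m, trigPoly, Submodule.coe_sum, SetLike.val_smul, Finset.sum_singleton,
      Pi.one_apply, one_smul]
    rw [← Finset.sum_coe_sort]
    simp [hc']
  refine ⟨f, fun k => ?_, ?_⟩
  · have := congrFun (LinearMap.mem_ker.1 hc) k
    simp only [φ, Matrix.mulVecLin_apply, Matrix.mulVec, dotProduct, Matrix.of_apply,
      Pi.zero_apply] at this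
    rw [hf, map_sum, ← this]
    exact Finset.sum_congr rfl fun h _ => by rw [map_smul, smul_eq_mul, mul_comm]
  · refine (pow_lt_pow_iff_left₀ (by have := normH_nonneg f; positivity) (norm_nonneg _)
      two_ne_zero).1 ?_
    rw [mul_pow, normH_sq_trigPoly hα hγ, norm_sq_trigPoly, Finset.mul_sum]
    obtain ⟨h0, hh0⟩ : ∃ h, c h ≠ 0 := by
      by_contra! hall
      exact hc0 (funext hall)
    have key : ∀ h ∈ A, ε ^ 2 * r α γ h < 1 := fun h hh => by
      have := hA h hh
      rw [Real.rpow_neg hε.le, Real.rpow_two, lt_inv_comm₀ (r_pos hα hγ h) (by positivity)] at this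
      rwa [← lt_inv_mul_iff₀' (r_pos hα hγ h), mul_one]
    refine Finset.sum_lt_sum (fun h hh => ?_) ⟨h0.1, h0.2, ?_⟩
    · rw [← mul_assoc]
      exact mul_le_of_le_one_left (sq_nonneg _) (key h hh).le
    · rw [← mul_assoc]
      refine mul_lt_of_lt_one_left ?_ (key _ h0.2)
      rw [hc']
      positivity

theorem CompBound.card_le (hα : 0 ≤ α) (hγ : ∀ j, 0 < γ j ∧ γ j ≤ 1) {Λ : InfoClass α γ}
    {C p q : ℝ} (hC : 0 ≤ C) (hb : CompBound Λ C p q) {M : ℝ} (hM : 1 < M) (hd : 1 ≤ d)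
    (A : Finset (Fin d → ℤ)) (hA : ∀ h ∈ A, r α γ h < M) :
    (A.card : ℝ) ≤ C * M ^ (p / 2) * (d : ℝ) ^ q := by
  have hM0 : 0 < M := by linarith
  set ε : ℝ := M ^ (-(1 / 2) : ℝ) with hε
  have hε0 : 0 < ε := by positivity
  have hε2 : ε ^ (-2 : ℝ) = M := by
    rw [hε, ← Real.rpow_mul hM0.le]; norm_num
  have h1 := card_le_comp hα hγ (Λ := Λ) hε0 A (by rwa [hε2])
  have h2 := hb ε hε0 (Real.rpow_lt_one_of_one_lt_of_neg hM (by norm_num)) d hd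
  have h3 : ε ^ (-p) = M ^ (p / 2) := by
    rw [hε, ← Real.rpow_mul hM0.le]; congr 1; ring
  rw [h3] at h2
  have h4 : ENNReal.ofReal A.card ≤ ENNReal.ofReal (C * M ^ (p / 2) * (d : ℝ) ^ q) := by
    refine le_trans ?_ h2
    rw [ENNReal.ofReal_natCast]
    exact_mod_cast h1
  exact (ENNReal.ofReal_le_ofReal_iff (by positivity)).1 h4

/-- In dimension one the frequencies `1, …, N` have weight at most `N ^ α / γ 0`, so `N ≤ const * N
^ (αp/2)` for all `N`. The factor 2 in `M` only makes the weight inequality strict. -/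
theorem CompBound.two_le (hα : 0 ≤ α) (hγ : ∀ j, 0 < γ j ∧ γ j ≤ 1) {Λ : InfoClass α γ}
    {C p q : ℝ} (hC : 0 ≤ C) (hb : CompBound Λ C p q) : 2 ≤ α * p := by
  by_contra! hlt
  have hg := hγ 0
  have key : ∀ N : ℕ, 1 ≤ N →
      (N : ℝ) ^ (1 - α * p / 2) ≤ C * (2 * (γ 0)⁻¹) ^ (p / 2) := fun N hN => by
    have hN1 : (1 : ℝ) ≤ N := by exact_mod_cast hN
    have hNα := Real.one_le_rpow hN1 hα
    have hginv := (one_le_inv₀ hg.1).2 hg.2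
    have h1 := hb.card_le hα hγ hC (M := 2 * (γ 0)⁻¹ * (N : ℝ) ^ α) (by nlinarith) le_rfl
      ((Finset.Icc 1 N).image fun k : ℕ => fun _ : Fin 1 => (k : ℤ)) (fun h hh => by
        simp only [Finset.mem_image, Finset.mem_Icc] at hh
        obtain ⟨k, hk, rfl⟩ := hh
        have hk1 : (k : ℝ) ≤ N := by exact_mod_cast hk.2
        simp only [r, Finset.univ_unique, Finset.prod_singleton, Fin.default_eq_zero, Fin.val_zero]
        refine (r1_le hg.1 hg.2 (by omega)).trans_lt ?_
        rw [Int.cast_natCast, abs_of_nonneg (by positivity)]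
        have := Real.rpow_le_rpow (by positivity) hk1 hα
        have h3 : (γ 0)⁻¹ * (k : ℝ) ^ α ≤ (γ 0)⁻¹ * (N : ℝ) ^ α := by gcongr
        nlinarith)
    rw [Finset.card_image_of_injective _ fun a b hab => by
      exact_mod_cast congrFun hab 0, Nat.card_Icc, Nat.add_sub_cancel, Nat.cast_one,
      Real.one_rpow, mul_one, Real.mul_rpow (by positivity) (by positivity),
      ← Real.rpow_mul (by positivity), ← mul_assoc] at h1
    rw [Real.rpow_sub (by positivity), Real.rpow_one, div_le_iff₀ (by positivity)]
    rwa [mul_div_assoc]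
  have ht := (tendsto_rpow_atTop (show 0 < 1 - α * p / 2 by linarith)).comp
    (tendsto_natCast_atTop_atTop (R := ℝ))
  obtain ⟨N, hN1, hN⟩ := ((ht.eventually_gt_atTop (C * (2 * (γ 0)⁻¹) ^ (p / 2))).and
    (eventually_ge_atTop 1)).exists
  exact absurd (key N hN) (not_le.2 hN1)

theorem r_indicator_le (hα : 0 ≤ α) (hγ : ∀ j, 0 < γ j ∧ γ j ≤ 1) (hanti : Antitone γ)
    (S : Finset (Fin (d + 1))) :
    r α γ (fun j => if j ∈ S then 1 else 0) ≤ (γ d)⁻¹ ^ S.card := by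
  have h1 : ∀ j : Fin (d + 1), r1 α (γ j) (if j ∈ S then 1 else 0) =
      if j ∈ S then r1 α (γ j) 1 else 1 := fun j => by
    split_ifs <;> simp
  rw [r, Finset.prod_congr rfl fun j _ => h1 j, Finset.prod_ite_mem, Finset.univ_inter,
    ← Finset.prod_const]
  refine Finset.prod_le_prod (fun j _ => zero_le_one.trans (one_le_r1 hα (hγ j).1 (hγ j).2 1))
    fun j _ => ?_
  refine (r1_le (hγ j).1 (hγ j).2 one_ne_zero).trans ?_
  simpa using inv_anti₀ (hγ d).1 (hanti (Nat.lt_succ_iff.1 j.2))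

/-- In dimension `d + 1` there are `(d+1).choose k` frequencies that are indicators of `k`-sets, and
monotonicity bounds their weights by `(γ d)⁻¹ ^ k`. Comparing the binomial, of order `(d+1) ^ k`,
with the assumed bound yields the decay of `γ d`. -/
theorem CompBound.pow_weight_le (hα : 0 ≤ α) (hγ : ∀ j, 0 < γ j ∧ γ j ≤ 1) (hanti : Antitone γ)
    {Λ : InfoClass α γ} {C p q : ℝ} (hC : 0 ≤ C) (hb : CompBound Λ C p q)
    {k : ℕ} (hk0 : 0 < k) (hd : 2 * k ≤ d + 1) :
    γ d ^ (k * p / 2) ≤ C * 2 ^ (p / 2) * k.factorial * 2 ^ k * ((d : ℝ) + 1) ^ (-(k - q)) := by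
  have hg := hγ d
  have hg0 := hg.1
  have hginv : 1 ≤ (γ d)⁻¹ ^ k := one_le_pow₀ ((one_le_inv₀ hg.1).2 hg.2)
  have h1 := hb.card_le hα hγ hC (M := 2 * (γ d)⁻¹ ^ k) (by linarith) (Nat.succ_pos d)
    ((Finset.powersetCard k Finset.univ).image fun (S : Finset (Fin (d + 1))) j =>
      if j ∈ S then (1 : ℤ) else 0) (fun h hh => by
        simp only [Finset.mem_image, Finset.mem_powersetCard] at hh
        obtain ⟨S, ⟨-, rfl⟩, rfl⟩ := hh
        refine (r_indicator_le hα hγ hanti S).trans_lt ?_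
        linarith)
  rw [Finset.card_image_of_injective _ fun S T hST => by
      ext j
      have := congrFun hST j
      by_cases h1 : j ∈ S <;> by_cases h2 : j ∈ T <;> simp_all,
    Finset.card_powersetCard, Finset.card_univ, Fintype.card_fin] at h1
  have h2 := (Nat.pow_le_choose (α := ℝ) k (d + 1)).trans h1
  -- `2k ≤ d + 1` gives `d + 2 - k ≥ (d + 1) / 2`, which turns the falling-factorial bound into a
  -- clean power.
  have h3 : (((d : ℝ) + 1) / 2) ^ k ≤ ((d + 1 + 1 - k : ℕ) : ℝ) ^ k := by
    refine pow_le_pow_left₀ (by positivity) ?_ k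
    rw [Nat.cast_sub (by omega)]
    push_cast
    have : 2 * (k : ℝ) ≤ d + 1 := by exact_mod_cast hd
    linarith
  rw [div_le_iff₀ (by positivity)] at h2
  have h4 := h3.trans h2
  have h5 : (2 * (γ d)⁻¹ ^ k) ^ (p / 2) = 2 ^ (p / 2) * (γ d ^ (k * p / 2))⁻¹ := by
    rw [Real.mul_rpow (by positivity) (by positivity), ← Real.rpow_natCast,
      ← Real.rpow_mul (by positivity), Real.inv_rpow hg.1.le, mul_div_assoc]
  have hpos : 0 < γ d ^ (k * p / 2) := Real.rpow_pos_of_pos hg.1 _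
  have hd0 : (0 : ℝ) < (d : ℝ) + 1 := by positivity
  rw [h5, div_pow, div_le_iff₀ (by positivity)] at h4
  push_cast at h4
  rw [neg_sub, Real.rpow_sub hd0, Real.rpow_natCast, mul_div_assoc', le_div_iff₀ (by positivity)]
  calc γ d ^ (k * p / 2) * ((d : ℝ) + 1) ^ k
      ≤ γ d ^ (k * p / 2) * (C * (2 ^ (p / 2) * (γ d ^ (k * p / 2))⁻¹) * ((d : ℝ) + 1) ^ q *
        k.factorial * 2 ^ k) := by gcongr
    _ = _ := by field_simp

/-- For any larger `s`, raising the decay of `γ d ^ (kp/2)` to a suitable power bounds `γ d ^ s` by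
a convergent zeta series. Taking `k = 1`, `q = 0` gives the sharp `p/2`; for general `q` only
finiteness is used. -/
theorem CompBound.sumExponent_le (hα : 0 ≤ α) (hγ : ∀ j, 0 < γ j ∧ γ j ≤ 1) (hanti : Antitone γ)
    {Λ : InfoClass α γ} {C p q : ℝ} (hC : 0 ≤ C) (hp : 0 < p) (hb : CompBound Λ C p q)
    {k : ℕ} (hk0 : 0 < k) (hk : q < k) :
    sumExponent γ ≤ ENNReal.ofReal (k * p / (2 * (k - q))) := by
  refine le_of_forall_gt fun c hc => ?_
  obtain ⟨s, hs1, hs2⟩ := ENNReal.lt_iff_exists_nnreal_btwn.1 hc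
  refine lt_of_le_of_lt (iInf₂_le s ⟨?_, ?_⟩) hs2
  · exact_mod_cast ENNReal.coe_pos.1 (bot_le.trans_lt hs1)
  rw [ENNReal.ofReal_lt_coe_iff (by positivity)] at hs1
  have hkq : 0 < (k : ℝ) - q := sub_pos.2 hk
  have hk' : (0 : ℝ) < k := by exact_mod_cast hk0
  -- The power that turns `γ d ^ (k * p / 2)` into `γ d ^ s`; the choice of `s` is exactly `(k - q)
  -- * t > 1`.
  set t : ℝ := s / (k * p / 2) with ht
  have hst : (s : ℝ) = k * p / 2 * t := by rw [ht]; field_simp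
  have ht0 : 0 ≤ t := by positivity
  have h1 : 1 < (k - q) * t := by
    rw [div_lt_iff₀ (by positivity), hst] at hs1
    have : 0 < k * p := by positivity
    nlinarith
  set K : ℝ := C * 2 ^ (p / 2) * k.factorial * 2 ^ k with hK
  have hsum : Summable fun d : ℕ => K ^ t * ((d : ℝ) + 1) ^ (-((k - q) * t)) :=
    (hasSum_zetaSum h1).summable.mul_left _
  refine hsum.of_norm_bounded_eventually_nat ?_
  filter_upwards [eventually_ge_atTop (2 * k)] with d hd
  have h2 := hb.pow_weight_le hα hγ hanti hC hk0 (d := d) (by omega)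
  rw [← hK] at h2
  have hg := (hγ d).1
  have h3 := Real.rpow_le_rpow (by positivity) h2 ht0
  rw [Real.norm_of_nonneg (by positivity), hst, Real.rpow_mul hg.le]
  refine h3.trans_eq ?_
  rw [Real.mul_rpow (by positivity) (by positivity), ← Real.rpow_mul (by positivity), neg_mul]

/-! ### Tractability for arbitrary continuous functionals -/

theorem Tractable.sumExponent_lt_top (hα : 0 ≤ α) (hγ : ∀ j, 0 < γ j ∧ γ j ≤ 1)
    (hanti : Antitone γ) {Λ : InfoClass α γ} (h : Tractable Λ) : sumExponent γ < ⊤ ∧ 0 < α := by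
  obtain ⟨C, p, q, hC, hp, hq, hb⟩ := h
  have h2 := hb.two_le hα hγ hC
  have hp0 : 0 < p := hp.lt_of_ne (by rintro rfl; linarith)
  obtain ⟨k, hk⟩ := exists_nat_gt q
  refine ⟨(hb.sumExponent_le hα hγ hanti hC hp0 (k := k) (by exact_mod_cast hq.trans_lt hk)
    hk).trans_lt ENNReal.ofReal_lt_top, hα.lt_of_ne (by rintro rfl; linarith)⟩

theorem StronglyTractable.tractable {Λ : InfoClass α γ} (h : StronglyTractable Λ) : Tractable Λ :=
  let ⟨C, p, hC, hp, hb⟩ := h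
  ⟨C, p, 0, hC, hp, le_rfl, hb⟩

theorem le_exponent (hα : 0 ≤ α) (hγ : ∀ j, 0 < γ j ∧ γ j ≤ 1)
    (hanti : Antitone γ) (Λ : InfoClass α γ) :
    2 * max (sumExponent γ) (ENNReal.ofReal α⁻¹) ≤ exponent Λ := by
  refine le_iInf₂ fun p ⟨C, hC, hb⟩ => ?_
  have h2 := hb.two_le hα hγ hC
  have hp0 : 0 < (p : ℝ) := p.2.lt_of_ne fun h0 => by
    change (0 : ℝ) = (p : ℝ) at h0
    rw [← h0] at h2
    linarith
  have hα0 : 0 < α := hα.lt_of_ne (by rintro rfl; linarith)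
  have h1 := hb.sumExponent_le hα hγ hanti hC hp0 one_pos (by simp)
  have h3 : max (sumExponent γ) (ENNReal.ofReal α⁻¹) ≤ ENNReal.ofReal (p / 2) := by
    refine max_le (h1.trans_eq (by congr 1; simp)) (ENNReal.ofReal_le_ofReal ?_)
    rw [inv_le_iff_one_le_mul₀ hα0]
    linarith
  calc _ ≤ 2 * ENNReal.ofReal (p / 2) := by gcongr
    _ = p := by
      rw [← ENNReal.ofReal_ofNat 2, ← ENNReal.ofReal_mul (by norm_num),
        mul_div_cancel₀ _ two_ne_zero, ENNReal.ofReal_coe_nnreal]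

theorem compBound_all_of_lt (hα : 0 < α) (hγ : ∀ j, 0 < γ j ∧ γ j ≤ 1) {s : ℝ≥0}
    (hs : max (sumExponent γ) (ENNReal.ofReal α⁻¹) < s) :
    ∃ C : ℝ, 0 ≤ C ∧ CompBound (LambdaAll α γ) C ((2 * s : ℝ≥0) : ℝ) 0 := by
  obtain ⟨h1, h2⟩ := max_lt_iff.1 hs
  rw [ENNReal.ofReal_lt_coe_iff (by positivity)] at h2
  simp only [sumExponent, iInf_lt_iff] at h1
  obtain ⟨s', ⟨hs'0, hs'⟩, hlt⟩ := h1
  push_cast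
  refine compBound_all hα hγ ?_ ?_
  · rwa [inv_lt_iff_one_lt_mul₀' hα] at h2
  · exact hs'.of_nonneg_of_le (fun j => Real.rpow_nonneg (hγ j).1.le _) fun j =>
      Real.rpow_le_rpow_of_exponent_ge (hγ j).1 (hγ j).2 (by exact_mod_cast hlt.le)

theorem exponent_all_le (hα : 0 < α) (hγ : ∀ j, 0 < γ j ∧ γ j ≤ 1) :
    exponent (LambdaAll α γ) ≤ 2 * max (sumExponent γ) (ENNReal.ofReal α⁻¹) := by
  rw [mul_comm, ← ENNReal.div_le_iff_le_mul (by simp) (by simp)]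
  refine le_of_forall_gt fun c hc => ?_
  obtain ⟨s, hs1, hs2⟩ := ENNReal.lt_iff_exists_nnreal_btwn.1 hc
  refine lt_of_le_of_lt ?_ hs2
  rw [ENNReal.div_le_iff_le_mul (by simp) (by simp), mul_comm]
  exact_mod_cast iInf₂_le (2 * s) (compBound_all_of_lt hα hγ hs1)

theorem stronglyTractable_all (hα : 0 < α) (hγ : ∀ j, 0 < γ j ∧ γ j ≤ 1)
    (hs : sumExponent γ < ⊤) : StronglyTractable (LambdaAll α γ) := by
  obtain ⟨s, hs1, -⟩ := ENNReal.lt_iff_exists_nnreal_btwn.1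
    (max_lt hs (ENNReal.ofReal_lt_top (r := α⁻¹)))
  obtain ⟨C, hC, hb⟩ := compBound_all_of_lt hα hγ hs1
  exact ⟨C, _, hC, NNReal.coe_nonneg _, hb⟩

/-! ### Function evaluations -/

/-- Cauchy-Schwarz on finite subsets, with summability of `w` as part of the conclusion. It is
applied with `u = 1/r` and `v = r |f̂|²`. -/
theorem summable_and_sq_tsum_le {ι : Type*} {u v w : ι → ℝ} (hu0 : ∀ i, 0 ≤ u i)
    (hv0 : ∀ i, 0 ≤ v i) (hw0 : ∀ i, 0 ≤ w i) (hw : ∀ i, w i ^ 2 = u i * v i)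
    (hu : Summable u) (hv : Summable v) :
    Summable w ∧ (∑' i, w i) ^ 2 ≤ (∑' i, u i) * ∑' i, v i := by
  have hU : 0 ≤ ∑' i, u i := tsum_nonneg hu0
  have hV : 0 ≤ ∑' i, v i := tsum_nonneg hv0
  have key : ∀ s : Finset ι, ∑ i ∈ s, w i ≤ √((∑' i, u i) * ∑' i, v i) := fun s => by
    refine Real.le_sqrt_of_sq_le ?_
    refine (Finset.sum_sq_le_sum_mul_sum_of_sq_le_mul s (fun i _ => hu0 i) (fun i _ => hv0 i)
      fun i _ => (hw i).le).trans ?_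
    have h1 := hu.sum_le_tsum s fun i _ => hu0 i
    have h2 := hv.sum_le_tsum s fun i _ => hv0 i
    have h3 : 0 ≤ ∑ i ∈ s, v i := Finset.sum_nonneg fun i _ => hv0 i
    gcongr
  have hs := summable_of_sum_le hw0 key
  refine ⟨hs, ?_⟩
  rw [← Real.sq_sqrt (mul_nonneg hU hV)]
  exact pow_le_pow_left₀ (tsum_nonneg hw0) (hs.tsum_le_of_sum_le key) 2

theorem hasSum_r_inv (hα : 1 < α) (hγ : ∀ j, 0 < γ j ∧ γ j ≤ 1) :
    HasSum (fun h : Fin d → ℤ => (r α γ h)⁻¹) (∏ j : Fin d, (1 + 2 * γ j * zetaSum α)) := by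
  have := hasSum_r_rpow (d := d) (zero_lt_one.trans hα) hγ (s := 1) (by linarith)
  simpa only [Real.rpow_neg_one, Real.rpow_one, mul_one] using this

theorem summable_norm_coeff (hα : 1 < α) (hγ : ∀ j, 0 < γ j ∧ γ j ≤ 1) (f : H α γ d) :
    (Summable fun h => ‖coeff (f : L2 d) h‖) ∧ (∑' h, ‖coeff (f : L2 d) h‖) ^ 2 ≤
      (∏ j : Fin d, (1 + 2 * γ j * zetaSum α)) * normH f ^ 2 := by
  have hα0 : 0 ≤ α := by linarith
  have hr : ∀ h : Fin d → ℤ, 0 < r α γ h := r_pos hα0 hγ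
  have hN := hasSum_normH_sq hα0 hγ f
  have hT := hasSum_r_inv (d := d) hα hγ
  rw [← hT.tsum_eq, ← hN.tsum_eq]
  refine summable_and_sq_tsum_le (fun h => (inv_pos.2 (hr h)).le)
    (fun h => mul_nonneg (hr h).le (sq_nonneg _)) (fun h => norm_nonneg _) (fun h => ?_)
    hT.summable hN.summable
  rw [inv_mul_cancel_left₀ (hr h).ne']

theorem hasSum_of_ae_eq (hα : 1 < α) (hγ : ∀ j, 0 < γ j ∧ γ j ≤ 1) (f : H α γ d)
    (g : C(UnitAddTorus (Fin d), ℂ))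
    (hfg : ((f : L2 d) : UnitAddTorus (Fin d) → ℂ) =ᵐ[cubeMeasure d] g)
    (x : UnitAddTorus (Fin d)) :
    HasSum (fun h => coeff (f : L2 d) h * UnitAddTorus.mFourier h x) (g x) := by
  have h1 : UnitAddTorus.mFourierCoeff g = coeff (f : L2 d) := by
    ext h
    refine (integral_congr_ae ?_).symm
    exact hfg.mono fun t ht => by simp only [ht]
  have h2 : Summable (UnitAddTorus.mFourierCoeff g) := by
    rw [h1]
    exact (summable_norm_coeff hα hγ f).1.of_norm
  have h3 := UnitAddTorus.hasSum_mFourier_series_apply_of_summable h2 x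
  simpa only [h1, smul_eq_mul] using h3

/-- The Fourier series converges absolutely in the uniform norm; its continuous sum and `f` are
limits of the same series in `L₂`. -/
theorem exists_continuous_ae_eq (hα : 1 < α) (hγ : ∀ j, 0 < γ j ∧ γ j ≤ 1) (f : H α γ d) :
    ∃ g : C(UnitAddTorus (Fin d), ℂ),
      ((f : L2 d) : UnitAddTorus (Fin d) → ℂ) =ᵐ[cubeMeasure d] g := by
  have h1 : Summable fun h => coeff (f : L2 d) h • UnitAddTorus.mFourier h :=
    Summable.of_norm <| by
      simpa only [norm_smul, UnitAddTorus.mFourier_norm, mul_one] using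
        (summable_norm_coeff hα hγ f).1
  refine ⟨∑' h, coeff (f : L2 d) h • UnitAddTorus.mFourier h, ?_⟩
  set g := ∑' h, coeff (f : L2 d) h • UnitAddTorus.mFourier h
  have h2 : HasSum (fun h => coeff (f : L2 d) h • (monomial h : L2 d))
      (ContinuousMap.toLp (E := ℂ) 2 (cubeMeasure d) ℂ g) := by
    have := h1.hasSum.mapL (ContinuousMap.toLp (E := ℂ) 2 (cubeMeasure d) ℂ)
    simp only [map_smul] at this
    have hm : ∀ h, (monomial h : L2 d) =
        ContinuousMap.toLp (E := ℂ) 2 (cubeMeasure d) ℂ (UnitAddTorus.mFourier h) := fun h => by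
      rw [monomial, UnitAddTorus.coe_mFourierBasis]
      rfl
    simpa only [hm] using this
  have h3 : HasSum (fun h => coeff (f : L2 d) h • (monomial h : L2 d)) (f : L2 d) := by
    simpa only [monomial, coeff_eq_repr] using UnitAddTorus.mFourierBasis.hasSum_repr (f : L2 d)
  rw [h3.unique h2]
  exact ContinuousMap.coeFn_toLp _ g

/-- Existence of a continuous representative is what keeps the condition defining `LambdaStd` from
being vacuous, so that it determines `L`. -/
theorem hasSum_of_mem_std (hα : 1 < α) (hγ : ∀ j, 0 < γ j ∧ γ j ≤ 1) {L : H α γ d →ₗ[ℂ] ℂ}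
    (hL : L ∈ LambdaStd α γ d) : ∃ x : UnitAddTorus (Fin d), ∀ f : H α γ d,
      HasSum (fun h => coeff (f : L2 d) h * UnitAddTorus.mFourier h x) (L f) := by
  obtain ⟨x, hx⟩ := hL
  refine ⟨x, fun f => ?_⟩
  obtain ⟨g, hg⟩ := exists_continuous_ae_eq hα hγ f
  rw [hx f g hg]
  exact hasSum_of_ae_eq hα hγ f g hg x

theorem norm_mFourier_apply (h : Fin d → ℤ) (x : UnitAddTorus (Fin d)) :
    ‖UnitAddTorus.mFourier h x‖ = 1 := by
  simp only [UnitAddTorus.mFourier, fourier_apply, ContinuousMap.coe_mk, norm_prod,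
    Circle.norm_coe, Finset.prod_const_one]

theorem summable_series (hα : 1 < α) (hγ : ∀ j, 0 < γ j ∧ γ j ≤ 1) (f : H α γ d)
    (x : UnitAddTorus (Fin d)) :
    Summable fun h => coeff (f : L2 d) h * UnitAddTorus.mFourier h x :=
  Summable.of_norm <| by
    simpa only [norm_mul, norm_mFourier_apply, mul_one] using (summable_norm_coeff hα hγ f).1

/-- The evaluation at the point `x` of the continuous representative, for `α > 1`. -/
def pointEval (hα : 1 < α) (hγ : ∀ j, 0 < γ j ∧ γ j ≤ 1) (x : UnitAddTorus (Fin d)) :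
    H α γ d →ₗ[ℂ] ℂ where
  toFun f := ∑' h, coeff (f : L2 d) h * UnitAddTorus.mFourier h x
  map_add' f g := by
    rw [← (summable_series hα hγ f x).tsum_add (summable_series hα hγ g x)]
    exact tsum_congr fun h => by rw [Submodule.coe_add, coeff_add, add_mul]
  map_smul' c f := by
    rw [RingHom.id_apply, smul_eq_mul, ← tsum_mul_left]
    exact tsum_congr fun h => by rw [Submodule.coe_smul, coeff_smul, mul_assoc]

theorem hasSum_pointEval (hα : 1 < α) (hγ : ∀ j, 0 < γ j ∧ γ j ≤ 1) (x : UnitAddTorus (Fin d))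
    (f : H α γ d) : HasSum (fun h => coeff (f : L2 d) h * UnitAddTorus.mFourier h x)
      (pointEval hα hγ x f) :=
  (summable_series hα hγ f x).hasSum

theorem pointEval_mem_std (hα : 1 < α) (hγ : ∀ j, 0 < γ j ∧ γ j ≤ 1)
    (x : UnitAddTorus (Fin d)) : pointEval hα hγ x ∈ LambdaStd α γ d :=
  ⟨x, fun f g hfg => (hasSum_pointEval hα hγ x f).unique (hasSum_of_ae_eq hα hγ f g hfg x)⟩

theorem std_subset_all (hα : 1 < α) (hγ : ∀ j, 0 < γ j ∧ γ j ≤ 1) :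
    LambdaStd α γ d ⊆ LambdaAll α γ d := fun L hL => by
  obtain ⟨x, hx⟩ := hasSum_of_mem_std hα hγ hL
  refine ⟨√(∏ j : Fin d, (1 + 2 * γ j * zetaSum α)), fun f => ?_⟩
  obtain ⟨h1, h2⟩ := summable_norm_coeff hα hγ f
  have h3 : ‖L f‖ ≤ ∑' h, ‖coeff (f : L2 d) h‖ := by
    rw [← (hx f).tsum_eq]
    refine (norm_tsum_le_tsum_norm (summable_series hα hγ f x).norm).trans_eq ?_
    exact tsum_congr fun h => by rw [norm_mul, norm_mFourier_apply, mul_one]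
  refine h3.trans ?_
  rw [← Real.sqrt_sq (normH_nonneg f), ← Real.sqrt_mul' _ (sq_nonneg _)]
  exact Real.le_sqrt_of_sq_le h2

theorem comp_all_le_comp_std (hα : 1 < α) (hγ : ∀ j, 0 < γ j ∧ γ j ≤ 1) (ε : ℝ) :
    comp (LambdaAll α γ) ε d ≤ comp (LambdaStd α γ) ε d :=
  le_iInf₂ fun n ⟨a, L, hL, hw⟩ => iInf₂_le n ⟨a, L, fun k => std_subset_all hα hγ (hL k), hw⟩

theorem exponent_all_le_exponent_std (hα : 1 < α) (hγ : ∀ j, 0 < γ j ∧ γ j ≤ 1) :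
    exponent (LambdaAll α γ) ≤ exponent (LambdaStd α γ) :=
  le_iInf₂ fun p ⟨C, hC, hb⟩ => iInf₂_le p ⟨C, hC, fun ε h0 h1 d hd =>
    (by exact_mod_cast comp_all_le_comp_std hα hγ ε : (comp (LambdaAll α γ) ε d : ℝ≥0∞) ≤
      comp (LambdaStd α γ) ε d).trans (hb ε h0 h1 d hd)⟩

/-! ### Lower bounds for function evaluations -/

/-- The squared trace of an operator of rank at most `n` is at most `n` times its squared
Hilbert-Schmidt norm, for operators `∑ c_k φ_k ⊗ φ_k^*`. -/
theorem norm_sum_mul_norm_sq_sq_le {ι : Type*} [Fintype ι] {n : ℕ}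
    (φ : Fin n → EuclideanSpace ℂ ι) (c : Fin n → ℂ) :
    ‖∑ k, c k * ((‖φ k‖ ^ 2 : ℝ) : ℂ)‖ ^ 2 ≤
      n * ∑ i, ∑ j, ‖∑ k, c k * φ k i * starRingEnd ℂ (φ k j)‖ ^ 2 := by
  classical
  set S := Submodule.span ℂ (Set.range φ) with hS
  let b := stdOrthonormalBasis ℂ S
  have hm : Module.finrank ℂ S ≤ n := (finrank_range_le_card (R := ℂ) φ).trans_eq (Fintype.card_fin n)
  have hφ : ∀ k, φ k ∈ S := fun k => Submodule.subset_span ⟨k, rfl⟩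
  let v : Fin (Module.finrank ℂ S) → EuclideanSpace ℂ ι := fun i => b i
  have hv : Orthonormal ℂ v := b.orthonormal.comp_linearIsometry S.subtypeₗᵢ
  have hpars : ∀ k, ∑ i, ‖inner ℂ (v i) (φ k)‖ ^ 2 = ‖φ k‖ ^ 2 := fun k => by
    have := b.sum_sq_norm_inner_right ⟨φ k, hφ k⟩
    simpa [v] using this
  -- `N i` is the conjugated `i`-th row of the matrix of `∑ c_k φ_k ⊗ φ_k^*`, and `T i` below is
  -- that operator applied to `v i`. The trace can be taken over the orthonormal family `v` because
  -- it spans all `φ k`; Bessel's inequality, row by row, bounds `∑ ‖T i‖²` by the squared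
  -- Hilbert-Schmidt norm.
  let N : ι → EuclideanSpace ℂ ι := fun i =>
    WithLp.toLp 2 fun j => starRingEnd ℂ (∑ k, c k * φ k i * starRingEnd ℂ (φ k j))
  let T : Fin (Module.finrank ℂ S) → EuclideanSpace ℂ ι := fun i =>
    ∑ k, (c k * inner ℂ (φ k) (v i)) • φ k
  have hT : ∀ i l, T i l = inner ℂ (N l) (v i) := fun i l => by
    simp only [T, N, PiLp.inner_apply, RCLike.inner_apply, WithLp.ofLp_sum, WithLp.ofLp_smul,
      Finset.sum_apply, Pi.smul_apply, smul_eq_mul, Finset.mul_sum, Finset.sum_mul,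
      RingHomCompTriple.comp_apply, RingHom.id_apply]
    rw [Finset.sum_comm]
    refine Finset.sum_congr rfl fun j _ => Finset.sum_congr rfl fun k _ => ?_
    ring
  have htr : ∑ k, c k * ((‖φ k‖ ^ 2 : ℝ) : ℂ) = ∑ i, inner ℂ (v i) (T i) := by
    simp only [T, inner_sum, inner_smul_right]
    rw [Finset.sum_comm]
    refine Finset.sum_congr rfl fun k _ => ?_
    rw [← hpars k, Complex.ofReal_sum, Finset.mul_sum]
    refine Finset.sum_congr rfl fun i _ => ?_
    rw [mul_assoc, ← inner_conj_symm (φ k) (v i), ← Complex.normSq_eq_conj_mul_self,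
      Complex.normSq_eq_norm_sq]
  have hTle : ∑ i, ‖T i‖ ^ 2 ≤ ∑ i, ∑ j, ‖∑ k, c k * φ k i * starRingEnd ℂ (φ k j)‖ ^ 2 := by
    simp only [EuclideanSpace.norm_sq_eq, hT]
    rw [Finset.sum_comm]
    refine Finset.sum_le_sum fun l _ => ?_
    have h1 := hv.sum_inner_products_le (N l) (s := Finset.univ)
    have h2 : ‖N l‖ ^ 2 = ∑ j, ‖∑ k, c k * φ k l * starRingEnd ℂ (φ k j)‖ ^ 2 := by
      rw [EuclideanSpace.norm_sq_eq]
      exact Finset.sum_congr rfl fun j _ => by rw [RCLike.norm_conj]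
    rw [← h2]
    refine le_trans (le_of_eq ?_) h1
    exact Finset.sum_congr rfl fun i _ => by rw [norm_inner_symm]
  rw [htr]
  calc ‖∑ i, inner ℂ (v i) (T i)‖ ^ 2 ≤ (∑ i, ‖T i‖) ^ 2 := by
        refine pow_le_pow_left₀ (norm_nonneg _) ((norm_sum_le _ _).trans
          (Finset.sum_le_sum fun i _ => ?_)) 2
        simpa [hv.1 i] using norm_inner_le_norm (𝕜 := ℂ) (v i) (T i)
    _ ≤ Module.finrank ℂ S * ∑ i, ‖T i‖ ^ 2 := by
        simpa using sq_sum_le_card_mul_sum_sq (s := Finset.univ) (f := fun i => ‖T i‖)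
    _ ≤ n * ∑ i, ‖T i‖ ^ 2 := by gcongr
    _ ≤ _ := by gcongr

/-- The difference of two elements of `{0, 1}`, encoded as booleans. -/
def boolDiff (p : Bool × Bool) : ℤ := (if p.1 then 1 else 0) - (if p.2 then 1 else 0)

/-- The two Fourier coefficients of the factor `√(1 - g²/4) + (g/2) e₁`. -/
def twoTerm (g : ℝ) (b : Bool) : ℝ := if b then g / 2 else √(1 - (g / 2) ^ 2)

theorem twoTerm_nonneg {g : ℝ} (hg : 0 < g) (b : Bool) : 0 ≤ twoTerm g b := by
  unfold twoTerm
  split_ifs <;> positivity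

/-- The left side is the `k`-th Fourier coefficient of `|√(1 - g²/4) + (g/2) e₁|²`: it is 1 at `k =
0` and at most `g/2` at `k = ±1`, against `1/r` equal to 1 and `g`. -/
theorem sum_fiber_twoTerm_le (hα : 0 < α) {g : ℝ} (hg : 0 < g) (hg1 : g ≤ 1) {k : ℤ}
    (hk : k ∈ Finset.Icc (-1 : ℤ) 1) :
    ∑ p : Bool × Bool with boolDiff p = k, twoTerm g p.1 * twoTerm g p.2 ≤ (r1 α g k)⁻¹ := by
  have h0 : 0 ≤ 1 - (g / 2) ^ 2 := by nlinarith
  have hs := Real.sq_sqrt h0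
  have hs1 : √(1 - (g / 2) ^ 2) ≤ 1 := Real.sqrt_le_one.2 (by nlinarith)
  have hs0 := Real.sqrt_nonneg (1 - (g / 2) ^ 2)
  rw [Finset.sum_filter, Fintype.sum_prod_type]
  simp only [Fintype.sum_bool, boolDiff, twoTerm]
  rw [Finset.mem_Icc] at hk
  obtain rfl | rfl | rfl : k = -1 ∨ k = 0 ∨ k = 1 := by omega
  · rw [r1_of_pos hα (by norm_num)]
    simp
    nlinarith
  · simp
    nlinarith
  · rw [r1_of_pos hα (by norm_num)]
    simp
    nlinarith

theorem one_add_le_sq_sum_twoTerm {g : ℝ} (hg : 0 < g) (hg1 : g ≤ 1) :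
    1 + g / 2 ≤ (∑ b, twoTerm g b) ^ 2 := by
  have h0 : 0 ≤ 1 - (g / 2) ^ 2 := by nlinarith
  have hs := Real.sq_sqrt h0
  have hs0 : 1 / 2 ≤ √(1 - (g / 2) ^ 2) := Real.le_sqrt_of_sq_le (by nlinarith)
  simp only [Fintype.sum_bool, twoTerm, if_true, Bool.false_eq_true, if_false]
  nlinarith

/-- The frequencies with coordinates in `{-1, 0, 1}`. -/
def signFreq (d : ℕ) : Finset (Fin d → ℤ) := Fintype.piFinset fun _ => Finset.Icc (-1 : ℤ) 1

/-- Grouping pairs by their difference `h` makes the inner sum factor over the coordinates, and each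
factor is a one-dimensional Fourier coefficient of `|q|²`. -/
theorem sum_pair_le (hα : 0 < α) (hγ : ∀ j, 0 < γ j ∧ γ j ≤ 1) {u : (Fin d → ℤ) → ℝ}
    (hu : ∀ h, 0 ≤ u h) :
    ∑ p : Fin d → Bool × Bool, (∏ j : Fin d, twoTerm (γ j) (p j).1 * twoTerm (γ j) (p j).2) *
      u (fun j => boolDiff (p j)) ≤ ∑ h ∈ signFreq d, (r α γ h)⁻¹ * u h := by
  have hmem : ∀ p ∈ (Finset.univ : Finset (Fin d → Bool × Bool)),
      (fun j => boolDiff (p j)) ∈ signFreq d := fun p _ => by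
    have : ∀ q, boolDiff q ∈ Finset.Icc (-1 : ℤ) 1 := by decide
    exact Fintype.mem_piFinset.2 fun j => this _
  rw [← Finset.sum_fiberwise_of_maps_to hmem]
  refine Finset.sum_le_sum fun h hh => ?_
  have h1 : ∀ p ∈ Finset.univ.filter (fun p : Fin d → Bool × Bool =>
      (fun j => boolDiff (p j)) = h), (∏ j : Fin d, twoTerm (γ j) (p j).1 * twoTerm (γ j) (p j).2) *
      u (fun j => boolDiff (p j)) =
      (∏ j : Fin d, twoTerm (γ j) (p j).1 * twoTerm (γ j) (p j).2) * u h := fun p hp => by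
    rw [(Finset.mem_filter.1 hp).2]
  rw [Finset.sum_congr rfl h1, ← Finset.sum_mul]
  refine mul_le_mul_of_nonneg_right ?_ (hu h)
  have h2 : Finset.univ.filter (fun p : Fin d → Bool × Bool => (fun j => boolDiff (p j)) = h) =
      Fintype.piFinset fun j => Finset.univ.filter fun q => boolDiff q = h j := by
    ext p
    simp [funext_iff]
  rw [h2, ← Finset.prod_univ_sum (fun j => Finset.univ.filter fun q => boolDiff q = h j)
    (fun j q => twoTerm (γ j) q.1 * twoTerm (γ j) q.2), r, ← Finset.prod_inv_distrib]
  refine Finset.prod_le_prod (fun j _ => Finset.sum_nonneg fun q _ => ?_) fun j _ => ?_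
  · exact mul_nonneg (twoTerm_nonneg (hγ j).1 _) (twoTerm_nonneg (hγ j).1 _)
  · exact sum_fiber_twoTerm_le hα (hγ j).1 (hγ j).2 (Fintype.mem_piFinset.1 hh j)

theorem exists_sub_sum_orthogonal {E : Type*} [NormedAddCommGroup E] [InnerProductSpace ℂ E]
    {n : ℕ} (κ : Fin n → E) (e : E) :
    ∃ c : Fin n → ℂ, ∀ k, inner ℂ (κ k) (e - ∑ i, c i • κ i) = 0 := by
  set S := Submodule.span ℂ (Set.range κ)
  have : FiniteDimensional ℂ S := FiniteDimensional.span_of_finite ℂ (Set.finite_range κ)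
  obtain ⟨c, hc⟩ := (Submodule.mem_span_range_iff_exists_fun ℂ).1 (S.starProjection_apply_mem e)
  refine ⟨c, fun k => ?_⟩
  rw [hc]
  exact (Submodule.mem_orthogonal _ _).1 (S.sub_starProjection_mem_orthogonal e) _
    (Submodule.subset_span ⟨k, rfl⟩)

/-- The positive definite kernel with coefficients `1 / r` dominates the kernel `|q|²`, where `q`
is the product of the functions `√(1 - γ_j²/4) + (γ_j/2) e₁`. -/
theorem sq_prod_mul_le (hα : 0 < α) (hγ : ∀ j, 0 < γ j ∧ γ j ≤ 1) {n : ℕ}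
    (x : Fin n → UnitAddTorus (Fin d)) (c : Fin n → ℂ) :
    (∏ j : Fin d, ∑ b, twoTerm (γ j) b) ^ 2 * ‖∑ k, c k‖ ^ 2 ≤ n * ∑ h ∈ signFreq d,
      (r α γ h)⁻¹ * ‖∑ k, c k * starRingEnd ℂ (UnitAddTorus.mFourier h (x k))‖ ^ 2 := by
  let A : (Fin d → Bool) → ℝ := fun g => ∏ j : Fin d, twoTerm (γ j) (g j)
  have hA : ∀ g, 0 ≤ A g := fun g => Finset.prod_nonneg fun j _ => twoTerm_nonneg (hγ j).1 _
  let ω : (Fin d → Bool) → Fin d → ℤ := fun g j => if g j then 1 else 0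
  let s : (Fin d → ℤ) → ℂ := fun h => ∑ k, c k * starRingEnd ℂ (UnitAddTorus.mFourier h (x k))
  -- Feature vectors of the kernel `q`: up to conjugation `⟪φ k, φ l⟫ = q(x_k - x_l)`, so `‖φ k‖² =
  -- q(0)`.
  let φ : Fin n → EuclideanSpace ℂ (Fin d → Bool) := fun k => WithLp.toLp 2 fun g =>
    (√(A g) : ℂ) * starRingEnd ℂ (UnitAddTorus.mFourier (ω g) (x k))
  have hφ : ∀ k, ‖φ k‖ ^ 2 = ∏ j : Fin d, ∑ b, twoTerm (γ j) b := fun k => by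
    rw [EuclideanSpace.norm_sq_eq, Finset.prod_univ_sum, Fintype.piFinset_univ]
    refine Finset.sum_congr rfl fun g _ => ?_
    simp only [φ, norm_mul, RCLike.norm_conj, norm_mFourier_apply, mul_one, Complex.norm_real]
    rw [Real.norm_of_nonneg (Real.sqrt_nonneg _), Real.sq_sqrt (hA g)]
  have h1 := norm_sum_mul_norm_sq_sq_le φ c
  simp only [hφ] at h1
  rw [← Finset.sum_mul, norm_mul, mul_pow, Complex.norm_real, Real.norm_eq_abs, sq_abs,
    mul_comm] at h1
  refine h1.trans (mul_le_mul_of_nonneg_left ?_ (Nat.cast_nonneg n))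
  refine le_trans (le_of_eq ?_) (sum_pair_le hα hγ (u := fun h => ‖s h‖ ^ 2) fun h => sq_nonneg _)
  rw [← Fintype.sum_prod_type' (f := fun g g' => ‖∑ k, c k * φ k g * starRingEnd ℂ (φ k g')‖ ^ 2),
    ← (Equiv.arrowProdEquivProdArrow (Fin d) (fun _ => Bool) fun _ => Bool).sum_comp]
  refine Finset.sum_congr rfl fun p _ => ?_
  set g : Fin d → Bool := fun j => (p j).1
  set g' : Fin d → Bool := fun j => (p j).2
  have h2 : (fun j => boolDiff (p j)) = ω g + -ω g' := by
    ext j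
    simp [boolDiff, ω, g, g', sub_eq_add_neg]
  have h3 : ∑ k, c k * φ k g * starRingEnd ℂ (φ k g') = (√(A g) * √(A g') : ℝ) * s (ω g + -ω g') := by
    simp only [φ, s, Finset.mul_sum, UnitAddTorus.mFourier_add, UnitAddTorus.mFourier_neg, map_mul,
      Complex.conj_conj, Complex.conj_ofReal, Complex.ofReal_mul]
    exact Finset.sum_congr rfl fun k _ => by ring
  have h4 : (∏ j : Fin d, twoTerm (γ j) (p j).1 * twoTerm (γ j) (p j).2) = A g * A g' :=
    Finset.prod_mul_distrib
  change ‖∑ k, c k * φ k g * starRingEnd ℂ (φ k g')‖ ^ 2 = _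
  rw [h2, h3, h4, norm_mul, Complex.norm_real, mul_pow, Real.norm_eq_abs, sq_abs, mul_pow,
    Real.sq_sqrt (hA g), Real.sq_sqrt (hA g')]

theorem zero_mem_signFreq : (0 : Fin d → ℤ) ∈ signFreq d :=
  Fintype.mem_piFinset.2 fun _ => by simp

/-- For every choice of `n` points there is a function in the Korobov space that vanishes at all
of them and whose mean is its squared Korobov norm, at least `1 - n / q(0)²`. -/
theorem exists_fooling (hα : 0 < α) (hγ : ∀ j, 0 < γ j ∧ γ j ≤ 1) {n : ℕ}
    (x : Fin n → UnitAddTorus (Fin d)) :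
    ∃ f : H α γ d, (∀ k, HasSum (fun h => coeff (f : L2 d) h * UnitAddTorus.mFourier h (x k)) 0) ∧
      1 - n / (∏ j : Fin d, ∑ b, twoTerm (γ j) b) ^ 2 ≤ normH f ^ 2 ∧
      normH f ^ 2 ≤ ‖(f : L2 d)‖ := by
  have hr : ∀ h : Fin d → ℤ, 0 < r α γ h := r_pos hα.le hγ
  set B := signFreq d
  set Q := (∏ j : Fin d, ∑ b, twoTerm (γ j) b) ^ 2 with hQ
  have hQ0 : 0 < Q := by
    refine pow_pos (Finset.prod_pos fun j _ => ?_) 2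
    have h1 := one_add_le_sq_sum_twoTerm (hγ j).1 (hγ j).2
    have h2 : 0 ≤ ∑ b, twoTerm (γ j) b := Finset.sum_nonneg fun b _ => twoTerm_nonneg (hγ j).1 b
    refine h2.lt_of_ne fun h => ?_
    rw [← h] at h1
    have := (hγ j).1
    linarith
  -- Coordinates are Fourier coefficients times `√r`, so that the Korobov norm is Euclidean and `κ
  -- k` represents evaluation at `x k`. The fooling function is the constant 1 minus its projection
  -- onto the span of the `κ k`.
  let κ : Fin n → EuclideanSpace ℂ B := fun k => WithLp.toLp 2 fun h =>
    ((√(r α γ h.1))⁻¹ : ℝ) * starRingEnd ℂ (UnitAddTorus.mFourier h.1 (x k))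
  let o : B := ⟨0, zero_mem_signFreq⟩
  obtain ⟨c, hc⟩ := exists_sub_sum_orthogonal κ (EuclideanSpace.single o (1 : ℂ))
  set F := EuclideanSpace.single o (1 : ℂ) - ∑ k, c k • κ k with hF
  -- `F` differs from the `o`-th unit vector by an element of the span to which it is orthogonal.
  have hFo : F o = ((‖F‖ ^ 2 : ℝ) : ℂ) := by
    have h1 : inner ℂ F F = (F o : ℂ) := by
      conv_lhs => rw [hF, inner_sub_left, ← hF]
      simp [sum_inner, inner_smul_left, hc, EuclideanSpace.inner_single_left]
    rw [← h1, inner_self_eq_norm_sq_to_K]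
    simp
  let s : (Fin d → ℤ) → ℂ := fun h => ∑ k, c k * starRingEnd ℂ (UnitAddTorus.mFourier h (x k))
  have hs0 : s 0 = ∑ k, c k := by
    simp [s, UnitAddTorus.mFourier_zero]
  have hFh : ∀ h : B, F h = (if h = o then 1 else 0) - ((√(r α γ h.1))⁻¹ : ℝ) * s h.1 := fun h => by
    simp only [hF, κ, s, PiLp.sub_apply, PiLp.single_apply, WithLp.ofLp_sum, WithLp.ofLp_smul,
      Finset.sum_apply, Pi.smul_apply, smul_eq_mul, Finset.mul_sum]
    congr 1
    exact Finset.sum_congr rfl fun k _ => by ring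
  have hFsq : ∀ h : B, ‖F h‖ ^ 2 =
      (r α γ h.1)⁻¹ * ‖s h.1‖ ^ 2 + if h = o then 1 - 2 * (s 0).re else 0 := fun h => by
    rw [hFh]
    split_ifs with hho
    · rw [hho]
      simp only [o, r_zero, Real.sqrt_one, inv_one, Complex.ofReal_one, one_mul]
      rw [← Complex.normSq_eq_norm_sq, ← Complex.normSq_eq_norm_sq, Complex.normSq_sub]
      simp
      ring
    · rw [zero_sub, norm_neg, norm_mul, mul_pow, add_zero, Complex.norm_real, norm_inv, inv_pow,
        Real.norm_of_nonneg (Real.sqrt_nonneg _), Real.sq_sqrt (hr _).le]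
  have hFnorm : ‖F‖ ^ 2 = ∑ h ∈ B, (r α γ h)⁻¹ * ‖s h‖ ^ 2 + (1 - 2 * (s 0).re) := by
    rw [EuclideanSpace.norm_sq_eq, Finset.sum_congr rfl fun h _ => hFsq h, Finset.sum_add_distrib,
      ← Finset.sum_coe_sort B]
    simp
  have hlow : 1 - n / Q ≤ ‖F‖ ^ 2 := by
    have h1 := sq_prod_mul_le hα hγ x c
    rw [← hs0, ← hQ] at h1
    change Q * ‖s 0‖ ^ 2 ≤ n * ∑ h ∈ B, (r α γ h)⁻¹ * ‖s h‖ ^ 2 at h1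
    set X := ∑ h ∈ B, (r α γ h)⁻¹ * ‖s h‖ ^ 2
    have hX : 0 ≤ X := Finset.sum_nonneg fun h _ => by have := hr h; positivity
    have h2 : ‖s 0‖ ^ 2 ≤ n / Q * X := by
      rw [div_mul_eq_mul_div, le_div_iff₀ hQ0]
      linarith
    -- Arithmetic-geometric mean applied to `‖s 0‖² ≤ (n/Q) X`; the `X` cancels in `‖F‖² = X + 1 - 2
    -- Re (s 0)`.
    have h3 : 2 * ‖s 0‖ ≤ n / Q + X := by
      refine (pow_le_pow_iff_left₀ (by positivity) (by positivity) two_ne_zero).1 ?_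
      nlinarith [sq_nonneg (n / Q - X)]
    have h4 := Complex.re_le_norm (s 0)
    rw [hFnorm]
    linarith
  let a : (Fin d → ℤ) → ℂ := fun h => if hh : h ∈ B then ((√(r α γ h))⁻¹ : ℝ) * F ⟨h, hh⟩ else 0
  have ha : ∀ h : B, a h.1 = ((√(r α γ h.1))⁻¹ : ℝ) * F h := fun h => by simp [a]
  refine ⟨⟨trigPoly B a, trigPoly_mem_H B a⟩, fun k => ?_, ?_⟩
  · have h1 : inner ℂ (κ k) F = ∑ h ∈ B, coeff (trigPoly B a) h * UnitAddTorus.mFourier h (x k) := by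
      rw [← Finset.sum_coe_sort, PiLp.inner_apply]
      refine Finset.sum_congr rfl fun h _ => ?_
      rw [coeff_trigPoly, if_pos h.2, ha]
      simp only [κ, RCLike.inner_apply, map_mul, Complex.conj_ofReal, Complex.conj_conj]
      ring
    rw [← hc k, h1]
    exact hasSum_sum_of_ne_finset_zero fun h hh => by rw [coeff_trigPoly, if_neg hh, zero_mul]
  · have h1 : normH (⟨trigPoly B a, trigPoly_mem_H B a⟩ : H α γ d) ^ 2 = ‖F‖ ^ 2 := by
      rw [normH_sq_trigPoly hα.le hγ, EuclideanSpace.norm_sq_eq, ← Finset.sum_coe_sort]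
      refine Finset.sum_congr rfl fun h _ => ?_
      rw [ha, norm_mul, mul_pow, Complex.norm_real, norm_inv, inv_pow,
        Real.norm_of_nonneg (Real.sqrt_nonneg _), Real.sq_sqrt (hr _).le,
        mul_inv_cancel_left₀ (hr _).ne']
    rw [h1]
    refine ⟨hlow, ?_⟩
    have h2 : ‖coeff (trigPoly B a) 0‖ = ‖F‖ ^ 2 := by
      rw [coeff_trigPoly, if_pos zero_mem_signFreq, ha o, hFo]
      simp [o]
    rw [← h2]
    refine (pow_le_pow_iff_left₀ (norm_nonneg _) (norm_nonneg _) two_ne_zero).1 ?_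
    exact le_hasSum (hasSum_norm_sq (trigPoly B a)) 0 fun _ _ => sq_nonneg _

theorem CompBound.exp_sum_le (hα : 1 < α) (hγ : ∀ j, 0 < γ j ∧ γ j ≤ 1) {C p q : ℝ} (hC : 0 ≤ C)
    (hb : CompBound (LambdaStd α γ) C p q) (hd : 1 ≤ d) :
    Real.exp ((∑ j ∈ Finset.range d, γ j) / 3) ≤ 2 * (C * (1 / 2 : ℝ) ^ (-p) * (d : ℝ) ^ q + 1) := by
  have hα0 : 0 < α := by linarith
  set Q := (∏ j : Fin d, ∑ b, twoTerm (γ j) b) ^ 2 with hQ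
  have hQle : Real.exp ((∑ j ∈ Finset.range d, γ j) / 3) ≤ Q := by
    rw [hQ, ← Finset.prod_pow, Finset.sum_div, Real.exp_sum,
      ← Fin.prod_univ_eq_prod_range fun j => Real.exp (γ j / 3)]
    refine Finset.prod_le_prod (fun j _ => (Real.exp_pos _).le) fun j _ => ?_
    refine le_trans ?_ (one_add_le_sq_sum_twoTerm (hγ j).1 (hγ j).2)
    have h1 := (hγ j).1
    have h2 := (hγ j).2
    have h3 := Real.exp_bound_div_one_sub_of_interval (x := γ j / 3) (by linarith) (by linarith)
    refine h3.trans ?_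
    rw [div_le_iff₀ (by linarith)]
    nlinarith
  have hQ0 : 0 < Q := (Real.exp_pos _).trans_le hQle
  -- For `n < 3Q/4` the fooling function has `normH f ^ 2 > 1/4`, hence `‖f‖ ≥ normH f ^ 2 > normH f
  -- / 2`: error `1/2` is not reached.
  have h1 : ((⌊3 / 4 * Q⌋₊ : ℕ) : ℕ∞) ≤ comp (LambdaStd α γ) (1 / 2) d := by
    refine le_comp hα0.le hγ (by norm_num) fun n hn L hL => ?_
    choose x hx using fun k => hasSum_of_mem_std hα hγ (hL k)
    obtain ⟨f, hf0, hf1, hf2⟩ := exists_fooling hα0 hγ x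
    refine ⟨f, fun k => (hx k f).unique (hf0 k), ?_⟩
    have hn' : (n : ℝ) < 3 / 4 * Q := by
      have h5 : ((n + 1 : ℕ) : ℝ) ≤ 3 / 4 * Q := (Nat.le_floor_iff (by positivity)).1 hn
      push_cast at h5
      linarith
    rw [← hQ] at hf1
    have h2 : (n : ℝ) / Q < 3 / 4 := by rwa [div_lt_iff₀ hQ0]
    have h3 := normH_nonneg f
    nlinarith
  have h2 := hb (1 / 2) (by norm_num) (by norm_num) d hd
  have h3 : ENNReal.ofReal (⌊3 / 4 * Q⌋₊ : ℕ) ≤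
      ENNReal.ofReal (C * (1 / 2) ^ (-p) * (d : ℝ) ^ q) := by
    refine le_trans ?_ h2
    rw [ENNReal.ofReal_natCast]
    exact_mod_cast h1
  rw [ENNReal.ofReal_le_ofReal_iff (by positivity)] at h3
  have h4 := Nat.lt_floor_add_one (3 / 4 * Q)
  linarith

/-! ### Rank-one lattices -/

section Lattice

variable {p : ℕ} [hp : Fact p.Prime]

/-- The residue of `h · z` modulo `p`. -/
def residue (z : Fin d → ZMod p) (h : Fin d → ℤ) : ZMod p := ∑ j, (h j : ZMod p) * z j

/-- The point number `i` of the rank-one lattice with `p` points and generator `z`. -/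
def latticePoint (z : Fin d → ZMod p) (i : ZMod p) : UnitAddTorus (Fin d) :=
  fun j => ZMod.toAddCircle (i * z j)

theorem addChar_map_sum {ι R : Type*} [AddCommMonoid R] (ψ : AddChar R ℂ) (s : Finset ι)
    (f : ι → R) : ψ (∑ i ∈ s, f i) = ∏ i ∈ s, ψ (f i) := by
  classical
  induction s using Finset.induction_on with
  | empty => simp
  | insert i s hi ih => rw [Finset.sum_insert hi, Finset.prod_insert hi, AddChar.map_add_eq_mul, ih]

theorem mFourier_latticePoint (z : Fin d → ZMod p) (i : ZMod p) (h : Fin d → ℤ) :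
    UnitAddTorus.mFourier h (latticePoint z i) = ZMod.stdAddChar (i * residue z h) := by
  rw [residue, Finset.mul_sum, addChar_map_sum]
  simp only [UnitAddTorus.mFourier, ContinuousMap.coe_mk]
  refine Finset.prod_congr rfl fun j _ => ?_
  rw [fourier_apply, latticePoint, ← map_zsmul, ZMod.stdAddChar_apply]
  have : (h j) • (i * z j) = i * ((h j : ZMod p) * z j) := by
    rw [zsmul_eq_mul]
    ring
  rw [this]
  rfl

/-- The lattice rule for the Fourier coefficient of frequency `h`. -/
def latticeCoeff (hα : 1 < α) (hγ : ∀ j, 0 < γ j ∧ γ j ≤ 1) (z : Fin d → ZMod p)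
    (h : Fin d → ℤ) (f : H α γ d) : ℂ :=
  ∑ i : ZMod p, pointEval hα hγ (latticePoint z i) f *
    ((p : ℂ)⁻¹ * ZMod.stdAddChar (-(i * residue z h)))

/-- Character orthogonality on `ZMod p`: the rule returns the sum of all coefficients whose
frequency has the same residue as `h`. -/
theorem hasSum_latticeCoeff (hα : 1 < α) (hγ : ∀ j, 0 < γ j ∧ γ j ≤ 1) (z : Fin d → ZMod p)
    (h : Fin d → ℤ) (f : H α γ d) :
    HasSum (fun k => if residue z k = residue z h then coeff (f : L2 d) k else 0)
      (latticeCoeff hα hγ z h f) := by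
  have h1 := hasSum_sum (s := Finset.univ) fun (i : ZMod p) _ =>
    (hasSum_pointEval hα hγ (latticePoint z i) f).mul_right
      ((p : ℂ)⁻¹ * ZMod.stdAddChar (-(i * residue z h)))
  refine h1.congr_fun fun k => ?_
  have hp0 : (p : ℂ) ≠ 0 := Nat.cast_ne_zero.2 hp.out.ne_zero
  have h2 := AddChar.sum_mulShift (residue z k - residue z h) (ZMod.isPrimitive_stdAddChar p)
  have h3 : ∀ i : ZMod p, coeff (f : L2 d) k * UnitAddTorus.mFourier k (latticePoint z i) *
      ((p : ℂ)⁻¹ * ZMod.stdAddChar (-(i * residue z h))) = coeff (f : L2 d) k * (p : ℂ)⁻¹ *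
      ZMod.stdAddChar (i * (residue z k - residue z h)) := fun i => by
    rw [mFourier_latticePoint, mul_sub, sub_eq_add_neg, AddChar.map_add_eq_mul]
    ring
  rw [Finset.sum_congr rfl fun i _ => h3 i, ← Finset.mul_sum, h2, ZMod.card]
  simp only [sub_eq_zero]
  split_ifs
  · rw [mul_assoc, inv_mul_cancel₀ hp0, mul_one]
  · simp

/-- The frequency `k` is an alias of `h` on the lattice with generator `z`. -/
def IsAlias (z : Fin d → ZMod p) (h k : Fin d → ℤ) : Prop := k ≠ h ∧ residue z k = residue z h

open scoped Classical in
/-- The sum of `1 / r` over all aliases of `h`. -/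
def aliasSum (α : ℝ) (γ : ℕ → ℝ) (z : Fin d → ZMod p) (h : Fin d → ℤ) : ℝ :=
  ∑' k, if IsAlias z h k then (r α γ k)⁻¹ else 0

theorem summable_ite_of_nonneg {ι : Type*} {u : ι → ℝ} (hu0 : ∀ i, 0 ≤ u i) (hu : Summable u)
    (P : ι → Prop) [DecidablePred P] : Summable fun i => if P i then u i else 0 :=
  hu.of_nonneg_of_le (fun i => by split_ifs; exacts [hu0 i, le_rfl])
    fun i => by split_ifs; exacts [le_rfl, hu0 i]

open scoped Classical in
theorem norm_latticeCoeff_sub_sq_le (hα : 1 < α) (hγ : ∀ j, 0 < γ j ∧ γ j ≤ 1)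
    (z : Fin d → ZMod p) (h : Fin d → ℤ) (f : H α γ d) :
    ‖coeff (f : L2 d) h - latticeCoeff hα hγ z h f‖ ^ 2 ≤ aliasSum α γ z h *
      ∑' k, if IsAlias z h k then r α γ k * ‖coeff (f : L2 d) k‖ ^ 2 else 0 := by
  have hr : ∀ h : Fin d → ℤ, 0 < r α γ h := r_pos (by linarith) hγ
  have h1 : HasSum (fun k => if IsAlias z h k then coeff (f : L2 d) k else 0)
      (latticeCoeff hα hγ z h f - coeff (f : L2 d) h) := by
    refine ((hasSum_latticeCoeff hα hγ z h f).sub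
      (hasSum_ite_eq h (coeff (f : L2 d) h))).congr_fun fun k => ?_
    by_cases hk : k = h
    · subst hk
      simp [IsAlias]
    · simp [IsAlias, hk]
  obtain ⟨hs, hle⟩ := summable_and_sq_tsum_le
    (u := fun k => if IsAlias z h k then (r α γ k)⁻¹ else 0)
    (v := fun k => if IsAlias z h k then r α γ k * ‖coeff (f : L2 d) k‖ ^ 2 else 0)
    (w := fun k => ‖if IsAlias z h k then coeff (f : L2 d) k else 0‖)
    (fun k => by have := hr k; split_ifs <;> positivity)
    (fun k => by have := hr k; split_ifs <;> positivity) (fun k => norm_nonneg _)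
    (fun k => by
      split_ifs
      · rw [inv_mul_cancel_left₀ (hr k).ne']
      · simp)
    (summable_ite_of_nonneg (fun k => (inv_pos.2 (hr k)).le) (hasSum_r_inv hα hγ).summable _)
    (summable_ite_of_nonneg (fun k => mul_nonneg (hr k).le (sq_nonneg _))
      (hasSum_normH_sq (by linarith) hγ f).summable _)
  refine le_trans ?_ hle
  rw [norm_sub_rev, ← h1.tsum_eq]
  exact pow_le_pow_left₀ (norm_nonneg _) (norm_tsum_le_tsum_norm hs) 2

theorem inv_r_le_aliasSum (hα : 1 < α) (hγ : ∀ j, 0 < γ j ∧ γ j ≤ 1) {z : Fin d → ZMod p}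
    {h k : Fin d → ℤ} (hk : IsAlias z h k) : (r α γ k)⁻¹ ≤ aliasSum α γ z h := by
  classical
  have hr : ∀ h : Fin d → ℤ, 0 ≤ (r α γ h)⁻¹ := fun h => (inv_pos.2 (r_pos (by linarith) hγ h)).le
  have := (summable_ite_of_nonneg hr (hasSum_r_inv hα hγ).summable (IsAlias z h)).le_tsum k
    fun k _ => by split_ifs; exacts [hr k, le_rfl]
  rw [if_pos hk] at this
  refine this.trans_eq ?_
  rw [aliasSum]

/-- The error of a lattice rule on a set of frequencies with few aliases. -/
theorem sum_norm_latticeCoeff_sub_sq_le (hα : 1 < α) (hγ : ∀ j, 0 < γ j ∧ γ j ≤ 1)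
    (z : Fin d → ZMod p) {M : ℝ} (hM : 0 < M) (R : Finset (Fin d → ℤ))
    (hR : ∀ h ∈ R, r α γ h ≤ M) (hR' : ∀ h ∈ R, aliasSum α γ z h < M⁻¹) (f : H α γ d) :
    ∑ h ∈ R, ‖coeff (f : L2 d) h - latticeCoeff hα hγ z h f‖ ^ 2 ≤ M⁻¹ * normH f ^ 2 := by
  classical
  have hr : ∀ h : Fin d → ℤ, 0 < r α γ h := r_pos (by linarith) hγ
  have hN := hasSum_normH_sq (by linarith) hγ f
  have hv0 : ∀ k, 0 ≤ r α γ k * ‖coeff (f : L2 d) k‖ ^ 2 := fun k =>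
    mul_nonneg (hr k).le (sq_nonneg _)
  have hsum : ∀ h, Summable fun k =>
      if IsAlias z h k then r α γ k * ‖coeff (f : L2 d) k‖ ^ 2 else 0 := fun h =>
    summable_ite_of_nonneg hv0 hN.summable _
  have h1 : ∀ h ∈ R, ‖coeff (f : L2 d) h - latticeCoeff hα hγ z h f‖ ^ 2 ≤
      M⁻¹ * ∑' k, if IsAlias z h k then r α γ k * ‖coeff (f : L2 d) k‖ ^ 2 else 0 := fun h hh => by
    refine (norm_latticeCoeff_sub_sq_le hα hγ z h f).trans ?_
    refine mul_le_mul_of_nonneg_right (hR' h hh).le ?_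
    exact tsum_nonneg fun k => by split_ifs; exacts [hv0 k, le_rfl]
  refine (Finset.sum_le_sum h1).trans ?_
  rw [← Finset.mul_sum, ← Summable.tsum_finsetSum fun h _ => hsum h]
  refine mul_le_mul_of_nonneg_left ?_ (inv_pos.2 hM).le
  rw [← hN.tsum_eq]
  refine (summable_sum fun h _ => hsum h).tsum_le_tsum (fun k => ?_) hN.summable
  -- Two members of `R` with equal residues would be aliases, putting a term `1/r ≥ M⁻¹` into an
  -- alias sum below `M⁻¹`. So the alias sets are disjoint, and the errors over all of `R` together
  -- cost one Korobov norm.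
  have hinj : ∀ h ∈ R, ∀ h' ∈ R, residue z h = residue z h' → h = h' := fun h hh h' hh' he => by
    by_contra hne
    have h2 := inv_r_le_aliasSum hα hγ (show IsAlias z h' h from ⟨hne, he⟩)
    have h3 := inv_anti₀ (hr h) (hR h hh)
    linarith [hR' h' hh']
  by_cases hex : ∃ h ∈ R, IsAlias z h k
  · obtain ⟨h, hh, hk⟩ := hex
    rw [Finset.sum_eq_single_of_mem h hh fun h' hh' hne => if_neg fun hk' =>
      hne (hinj h' hh' h hh (hk'.2.symm.trans hk.2)), if_pos hk]
  · push Not at hex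
    rw [Finset.sum_eq_zero fun h hh => if_neg (hex h hh)]
    exact hv0 k

/-! ### Averages over all lattice generators -/

theorem residue_sub (z : Fin d → ZMod p) (h k : Fin d → ℤ) :
    residue z (k - h) = residue z k - residue z h := by
  simp [residue, sub_mul, Finset.sum_sub_distrib]

/-- The residue is a surjective homomorphism in `z` as soon as one coordinate of `k` is a unit mod
`p`, so its kernel has index `p`. -/
theorem card_residue_eq_zero {k : Fin d → ℤ} {j : Fin d} (hk : (k j : ZMod p) ≠ 0) :
    p * (Finset.univ.filter fun z : Fin d → ZMod p => residue z k = 0).card = p ^ d := by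
  classical
  let φ : (Fin d → ZMod p) →+ ZMod p :=
    { toFun := fun z => residue z k
      map_zero' := by simp [residue]
      map_add' := fun y z => by simp [residue, mul_add, Finset.sum_add_distrib] }
  have hsurj : Function.Surjective φ := fun y => by
    refine ⟨Pi.single j ((k j : ZMod p)⁻¹ * y), ?_⟩
    change ∑ i, (k i : ZMod p) * (Pi.single j ((k j : ZMod p)⁻¹ * y) : Fin d → ZMod p) i = y
    rw [Finset.sum_eq_single j (fun i _ hi => by rw [Pi.single_eq_of_ne hi, mul_zero])
      (fun h => absurd (Finset.mem_univ j) h), Pi.single_eq_same, mul_inv_cancel_left₀ hk]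
  have h1 := φ.ker.index_mul_card
  rw [AddSubgroup.index_ker, AddMonoidHom.range_eq_top.2 hsurj, AddSubgroup.card_top,
    Nat.card_zmod, Nat.card_eq_fintype_card (α := Fin d → ZMod p), Fintype.card_fun,
    ZMod.card, Fintype.card_fin] at h1
  rw [← h1]
  congr 1
  rw [Nat.card_eq_fintype_card, ← Fintype.card_coe]
  exact Fintype.card_congr (Equiv.subtypeEquivRight fun z => by
    rw [AddMonoidHom.mem_ker, Finset.mem_filter]
    exact ⟨fun h => h.2, fun h => ⟨Finset.mem_univ _, h⟩⟩)

/-- For `|h| ≤ p/2` one has `|h + pl| ≥ p|l| - p/2 ≥ (p/2)|l|`, and `(p/2) ^ α ≥ p/2`. -/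
theorem r1_mul_le_r1_add (hα : 1 < α) {g : ℝ} (hg : 0 < g) {h l : ℤ}
    (hh : 2 * |(h : ℝ)| ≤ p) (hl : l ≠ 0) : (p : ℝ) / 2 * r1 α g l ≤ r1 α g (h + p * l) := by
  have hp2 : (2 : ℝ) ≤ p := by exact_mod_cast hp.out.two_le
  have hl1 : (1 : ℝ) ≤ |(l : ℝ)| := by exact_mod_cast Int.one_le_abs hl
  have h1 : (p : ℝ) / 2 * |(l : ℝ)| ≤ |((h + p * l : ℤ) : ℝ)| := by
    push_cast
    have h2 := abs_sub_abs_le_abs_sub ((p : ℝ) * l) (-h)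
    rw [sub_neg_eq_add, abs_neg, abs_mul, Nat.abs_cast, add_comm] at h2
    nlinarith
  have hne : h + p * l ≠ 0 := fun h0 => by
    rw [h0, Int.cast_zero, abs_zero] at h1
    nlinarith
  have hα0 : 0 < α := by linarith
  rw [r1_of_pos hα0 hl, r1_of_pos hα0 hne]
  calc (p : ℝ) / 2 * (g⁻¹ * |(l : ℝ)| ^ α) = g⁻¹ * ((p : ℝ) / 2 * |(l : ℝ)| ^ α) := by ring
    _ ≤ g⁻¹ * (((p : ℝ) / 2) ^ α * |(l : ℝ)| ^ α) := by
      gcongr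
      exact Real.self_le_rpow_of_one_le (by linarith) hα.le
    _ = g⁻¹ * ((p : ℝ) / 2 * |(l : ℝ)|) ^ α := by
      rw [Real.mul_rpow (by positivity) (by positivity)]
    _ ≤ _ := by gcongr

theorem r_mul_le_r_add (hα : 1 < α) (hγ : ∀ j, 0 < γ j ∧ γ j ≤ 1) {h l : Fin d → ℤ}
    (hh : ∀ j, 2 * |(h j : ℝ)| ≤ p) (hl : l ≠ 0) :
    (p : ℝ) / 2 * r α γ l ≤ r α γ (h + (p : ℤ) • l) := by
  have hp2 : (2 : ℝ) ≤ p := by exact_mod_cast hp.out.two_le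
  have hone : ∀ (j : Fin d) k, 1 ≤ r1 α (γ j) k := fun j k =>
    one_le_r1 (by linarith) (hγ j).1 (hγ j).2 k
  obtain ⟨j, hj⟩ := Function.ne_iff.1 hl
  rw [r, r, ← Finset.mul_prod_erase _ _ (Finset.mem_univ j),
    ← Finset.mul_prod_erase _ _ (Finset.mem_univ j), ← mul_assoc]
  refine mul_le_mul (r1_mul_le_r1_add hα (hγ j).1 (hh j) hj) ?_
    (Finset.prod_nonneg fun i _ => zero_le_one.trans (hone i _)) (zero_le_one.trans (hone j _))
  refine Finset.prod_le_prod (fun i _ => zero_le_one.trans (hone i _)) fun i _ => ?_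
  by_cases hi : l i = 0
  · rw [hi, r1_zero]
    exact hone i _
  · refine le_trans ?_ (r1_mul_le_r1_add hα (hγ i).1 (hh i) hi)
    exact le_mul_of_one_le_left (zero_le_one.trans (hone i _)) (by linarith)

-- Frequencies congruent to `h` in every coordinate are aliases for every generator, so averaging
-- does not help. They are `h + p l` with `l ≠ 0`, and their weights gain a factor `p/2`.
open scoped Classical in
theorem tsum_congruent_le (hα : 1 < α) (hγ : ∀ j, 0 < γ j ∧ γ j ≤ 1) {h : Fin d → ℤ}
    (hh : ∀ j, 2 * |(h j : ℝ)| ≤ p) :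
    ∑' k, (if k ≠ h ∧ ∀ j, ((k - h) j : ZMod p) = 0 then (r α γ k)⁻¹ else 0) ≤
      2 / p * ∏ j : Fin d, (1 + 2 * γ j * zetaSum α) := by
  have hp0 : (p : ℤ) ≠ 0 := by exact_mod_cast hp.out.ne_zero
  have hp0' : (0 : ℝ) < p := by exact_mod_cast hp.out.pos
  have hr : ∀ h : Fin d → ℤ, 0 < r α γ h := r_pos (by linarith) hγ
  have hr' : ∀ h : Fin d → ℤ, 0 ≤ (r α γ h)⁻¹ := fun h => (inv_pos.2 (hr h)).le
  have hT := hasSum_r_inv (d := d) hα hγ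
  let e : (Fin d → ℤ) → Fin d → ℤ := fun l => h + (p : ℤ) • l
  have he : Function.Injective e := fun l l' hll' => by
    ext j
    have := congrFun hll' j
    simpa [e, hp.out.ne_zero] using this
  set u : (Fin d → ℤ) → ℝ :=
    fun k => if k ≠ h ∧ ∀ j, ((k - h) j : ZMod p) = 0 then (r α γ k)⁻¹ else 0 with hu
  have hus : Summable u := summable_ite_of_nonneg hr' hT.summable _
  rw [← he.tsum_eq (f := u) fun k hk => ?_]
  · rw [← hT.tsum_eq, ← tsum_mul_left]
    refine (hus.comp_injective he).tsum_le_tsum (fun l => ?_) (hT.summable.mul_left _)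
    simp only [hu, e]
    split_ifs with hl
    · have hl0 : l ≠ 0 := by
        rintro rfl
        simp at hl
      have := inv_anti₀ (by have := hr l; positivity) (r_mul_le_r_add hα hγ hh hl0)
      rwa [mul_inv, inv_div] at this
    · have := hr' l
      positivity
  · have hk' : k ≠ h ∧ ∀ j, ((k - h) j : ZMod p) = 0 := by
      by_contra hcon
      exact hk (if_neg hcon)
    choose l hl using fun j => (ZMod.intCast_zmod_eq_zero_iff_dvd _ p).1 (hk'.2 j)
    refine ⟨l, ?_⟩
    ext j
    have := hl j
    simp only [Pi.sub_apply] at this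
    simp only [e, Pi.add_apply, Pi.smul_apply, smul_eq_mul]
    omega

/-- After exchanging sums, a `k` not congruent to `h` is an alias for a fraction `1/p` of the
generators; the congruent ones contribute the remaining `2/p`. -/
theorem sum_aliasSum_le (hα : 1 < α) (hγ : ∀ j, 0 < γ j ∧ γ j ≤ 1) {h : Fin d → ℤ}
    (hh : ∀ j, 2 * |(h j : ℝ)| ≤ p) :
    ∑ z : Fin d → ZMod p, aliasSum α γ z h ≤
      (p : ℝ) ^ d * (3 / p * ∏ j : Fin d, (1 + 2 * γ j * zetaSum α)) := by
  classical
  have hp0 : (0 : ℝ) < p := by exact_mod_cast hp.out.pos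
  have hr : ∀ h : Fin d → ℤ, 0 < r α γ h := r_pos (by linarith) hγ
  have hr' : ∀ h : Fin d → ℤ, 0 ≤ (r α γ h)⁻¹ := fun h => (inv_pos.2 (hr h)).le
  have hT := hasSum_r_inv (d := d) hα hγ
  have hs : ∀ z : Fin d → ZMod p, Summable fun k =>
      if IsAlias z h k then (r α γ k)⁻¹ else 0 := fun z =>
    summable_ite_of_nonneg hr' hT.summable _
  have hsc := summable_ite_of_nonneg hr' hT.summable
    fun k => k ≠ h ∧ ∀ j, ((k - h) j : ZMod p) = 0
  have h0 : ∀ z : Fin d → ZMod p, aliasSum α γ z h =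
      ∑' k, if IsAlias z h k then (r α γ k)⁻¹ else 0 := fun z => by
    rw [aliasSum]
  simp only [h0]
  rw [← Summable.tsum_finsetSum fun z _ => hs z]
  have key : ∀ k, ∑ z : Fin d → ZMod p, (if IsAlias z h k then (r α γ k)⁻¹ else 0) ≤
      (p : ℝ) ^ d * (1 / p * (r α γ k)⁻¹ +
        if k ≠ h ∧ ∀ j, ((k - h) j : ZMod p) = 0 then (r α γ k)⁻¹ else 0) := fun k => by
    have hk := hr' k
    rw [← Finset.sum_filter, Finset.sum_const, nsmul_eq_mul]
    by_cases hkh : k = h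
    · rw [Finset.filter_false_of_mem fun z _ hz => hz.1 hkh]
      simp only [Finset.card_empty, Nat.cast_zero, zero_mul]
      split_ifs <;> positivity
    by_cases hc : ∀ j, ((k - h) j : ZMod p) = 0
    · rw [if_pos ⟨hkh, hc⟩]
      have h1 : ((Finset.univ.filter fun z : Fin d → ZMod p => IsAlias z h k).card : ℝ) ≤
          (p : ℝ) ^ d := by
        have := Finset.card_le_univ (Finset.univ.filter fun z : Fin d → ZMod p => IsAlias z h k)
        rw [Fintype.card_fun, ZMod.card, Fintype.card_fin] at this
        exact_mod_cast this
      refine mul_le_mul h1 ?_ hk (by positivity)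
      have : 0 ≤ 1 / (p : ℝ) * (r α γ k)⁻¹ := by positivity
      linarith
    · rw [if_neg fun hcon => hc hcon.2, add_zero, ← mul_assoc]
      push Not at hc
      obtain ⟨j, hj⟩ := hc
      refine mul_le_mul_of_nonneg_right ?_ hk
      have h1 := card_residue_eq_zero hj
      have h2 : (Finset.univ.filter fun z : Fin d → ZMod p => IsAlias z h k) =
          Finset.univ.filter fun z : Fin d → ZMod p => residue z (k - h) = 0 := by
        ext z
        simp [IsAlias, hkh, residue_sub, sub_eq_zero]
      rw [h2, mul_one_div, le_div_iff₀ hp0, mul_comm]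
      exact_mod_cast h1.le
  refine ((summable_sum fun z _ => hs z).tsum_le_tsum key
    (((hT.summable.mul_left _).add hsc).mul_left _)).trans ?_
  rw [tsum_mul_left, (hT.summable.mul_left _).tsum_add hsc, tsum_mul_left, hT.tsum_eq]
  refine mul_le_mul_of_nonneg_left ?_ (by positivity)
  have h3 := tsum_congruent_le hα hγ hh
  calc _ ≤ 1 / (p : ℝ) * (∏ j : Fin d, (1 + 2 * γ j * zetaSum α)) +
        2 / p * ∏ j : Fin d, (1 + 2 * γ j * zetaSum α) := by gcongr
    _ = _ := by ring

theorem two_mul_card_le (hα : 1 < α) (hγ : ∀ j, 0 < γ j ∧ γ j ≤ 1) {M : ℝ} (hM : 0 < M)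
    (hMp : 6 * M * (∏ j : Fin d, (1 + 2 * γ j * zetaSum α)) ≤ p) {h : Fin d → ℤ}
    (hh : ∀ j, 2 * |(h j : ℝ)| ≤ p) [DecidablePred fun z : Fin d → ZMod p => M⁻¹ ≤ aliasSum α γ z h] :
    2 * (Finset.univ.filter fun z : Fin d → ZMod p => M⁻¹ ≤ aliasSum α γ z h).card ≤
      Fintype.card (Fin d → ZMod p) := by
  have hp0 : (0 : ℝ) < p := by exact_mod_cast hp.out.pos
  have hnn : ∀ z : Fin d → ZMod p, 0 ≤ aliasSum α γ z h := fun z =>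
    tsum_nonneg fun k => by
      split_ifs
      exacts [(inv_pos.2 (r_pos (by linarith) hγ k)).le, le_rfl]
  have h1 : (Finset.univ.filter fun z : Fin d → ZMod p => M⁻¹ ≤ aliasSum α γ z h).card • M⁻¹ ≤
      ∑ z : Fin d → ZMod p, aliasSum α γ z h :=
    (Finset.card_nsmul_le_sum _ _ _ fun z hz => (Finset.mem_filter.1 hz).2).trans
      (Finset.sum_le_univ_sum_of_nonneg hnn)
  have h2 := h1.trans (sum_aliasSum_le hα hγ hh)
  rw [nsmul_eq_mul, ← div_eq_mul_inv, div_le_iff₀ hM] at h2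
  have h3 : (p : ℝ) ^ d * (3 / p * ∏ j : Fin d, (1 + 2 * γ j * zetaSum α)) * M ≤
      (p : ℝ) ^ d / 2 := by
    rw [show (p : ℝ) ^ d * (3 / p * ∏ j : Fin d, (1 + 2 * γ j * zetaSum α)) * M =
      (p : ℝ) ^ d / 2 * ((6 * M * ∏ j : Fin d, (1 + 2 * γ j * zetaSum α)) / p) by ring]
    exact mul_le_of_le_one_right (by positivity) ((div_le_one hp0).2 hMp)
  rw [Fintype.card_fun, ZMod.card, Fintype.card_fin]
  have h4 := h2.trans h3
  rw [le_div_iff₀ two_pos, mul_comm] at h4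
  exact_mod_cast h4

end Lattice

/-- If every `h ∈ A` is bad for at most half of the elements of `Z`, then fewer than `2 ^ L`
elements `h` can be served by `L` elements of `Z`. -/
theorem exists_forall_exists_not {ι Z : Type*} [Fintype Z] [Nonempty Z] (bad : ι → Z → Prop)
    [∀ h, DecidablePred (bad h)] (L : ℕ) (A : Finset ι) (hL : A.card < 2 ^ L)
    (hA : ∀ h ∈ A, 2 * (Finset.univ.filter (bad h)).card ≤ Fintype.card Z) :
    ∃ zs : Fin L → Z, ∀ h ∈ A, ∃ l, ¬ bad h (zs l) := by
  induction L generalizing A with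
  | zero =>
    refine ⟨fun l => l.elim0, fun h hh => ?_⟩
    rw [pow_zero, Nat.lt_one_iff, Finset.card_eq_zero] at hL
    simp [hL] at hh
  | succ L ih =>
    -- Double counting: some `z` is bad for at most half of `A`, and the induction continues on that
    -- half.
    have h1 : ∑ z : Z, 2 * (A.filter fun h => bad h z).card ≤ ∑ _z : Z, A.card := by
      rw [← Finset.mul_sum, Finset.sum_const, Finset.card_univ, smul_eq_mul]
      simp only [Finset.card_filter]
      rw [Finset.sum_comm, Finset.mul_sum, mul_comm, ← smul_eq_mul, ← Finset.sum_const]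
      refine Finset.sum_le_sum fun h hh => ?_
      rw [← Finset.card_filter]
      exact hA h hh
    obtain ⟨z, -, hz⟩ := Finset.exists_le_of_sum_le Finset.univ_nonempty h1
    obtain ⟨zs, hzs⟩ := ih (A.filter fun h => bad h z) (by rw [pow_succ] at hL; omega)
      fun h hh => hA h (Finset.mem_filter.1 hh).1
    refine ⟨Fin.cons z zs, fun h hh => ?_⟩
    by_cases hb : bad h z
    · obtain ⟨l, hl⟩ := hzs h (Finset.mem_filter.2 ⟨hh, hb⟩)
      exact ⟨l.succ, by simpa using hl⟩
    · exact ⟨0, by simpa using hb⟩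

/-! ### Upper bounds for function evaluations -/

theorem abs_le_r (hα : 1 < α) (hγ : ∀ j, 0 < γ j ∧ γ j ≤ 1) (h : Fin d → ℤ) (j : Fin d) :
    |(h j : ℝ)| ≤ r α γ h := by
  have hone : ∀ (j : Fin d) k, 1 ≤ r1 α (γ j) k := fun j k =>
    one_le_r1 (by linarith) (hγ j).1 (hγ j).2 k
  have h1 : |(h j : ℝ)| ≤ r1 α (γ j) (h j) := by
    by_cases h0 : h j = 0
    · simp [h0]
    · rw [r1_of_pos (by linarith) h0]
      have h2 : (1 : ℝ) ≤ |(h j : ℝ)| := by exact_mod_cast Int.one_le_abs h0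
      exact (Real.self_le_rpow_of_one_le h2 hα.le).trans
        (le_mul_of_one_le_left (by positivity) ((one_le_inv₀ (hγ j).1).2 (hγ j).2))
  refine h1.trans ?_
  rw [r, ← Finset.mul_prod_erase _ _ (Finset.mem_univ j)]
  refine le_mul_of_one_le_right (zero_le_one.trans (hone _ _)) ?_
  rw [← Finset.prod_const_one (s := Finset.univ.erase j)]
  exact Finset.prod_le_prod (fun _ _ => zero_le_one) fun i _ => hone _ _

theorem one_le_prod_zeta (hα : 1 < α) (hγ : ∀ j, 0 < γ j ∧ γ j ≤ 1) (d : ℕ) :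
    1 ≤ ∏ j : Fin d, (1 + 2 * γ j * zetaSum α) := by
  have hZ := one_le_zetaSum hα
  refine (Finset.prod_const_one (s := Finset.univ (α := Fin d))).symm.trans_le ?_
  refine Finset.prod_le_prod (fun _ _ => zero_le_one) fun j _ => ?_
  have := (hγ j).1
  have : 0 ≤ 2 * γ j * zetaSum α := by positivity
  linarith

/-- Each low frequency is assigned to one of `L + 1` lattices on which its alias sum is below `M⁻¹`.
The squared error is at most `1/M` from truncation plus `1/M` per lattice, which explains `(L + 2) /
M`. -/
theorem comp_std_le (hα : 1 < α) (hγ : ∀ j, 0 < γ j ∧ γ j ≤ 1) {M ε : ℝ} (hM : 1 ≤ M)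
    (hε : 0 ≤ ε) {p L : ℕ} [hp : Fact p.Prime]
    (hMp : 6 * M * (∏ j : Fin d, (1 + 2 * γ j * zetaSum α)) ≤ p)
    (hL : (lowFreq (zero_lt_one.trans hα) hγ d M).card < 2 ^ (L + 1))
    (hLM : (L + 2) / M ≤ ε ^ 2) :
    comp (LambdaStd α γ) ε d ≤ ((L + 1) * p : ℕ) := by
  classical
  have hM0 : 0 < M := by linarith
  set A := lowFreq (zero_lt_one.trans hα) hγ d M with hA
  have hT := one_le_prod_zeta hα hγ d
  have hAp : ∀ h ∈ A, ∀ j, 2 * |(h j : ℝ)| ≤ p := fun h hh j => by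
    have h1 := (abs_le_r hα hγ h j).trans (mem_lowFreq.1 hh)
    nlinarith
  obtain ⟨zs, hzs⟩ := exists_forall_exists_not
    (fun (h : Fin d → ℤ) (z : Fin d → ZMod p) => M⁻¹ ≤ aliasSum α γ z h) (L + 1) A hL
    fun h hh => two_mul_card_le hα hγ hM0 hMp (hAp h hh)
  have hex : ∀ h, ∃ l, h ∈ A → aliasSum α γ (zs l) h < M⁻¹ := fun h => by
    by_cases hh : h ∈ A
    · obtain ⟨l, hl⟩ := hzs h hh
      exact ⟨l, fun _ => not_le.1 hl⟩
    · exact ⟨0, fun h => absurd h hh⟩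
  choose lev hlev using hex
  have hcard : Fintype.card (Fin (L + 1) × ZMod p) = (L + 1) * p := by
    rw [Fintype.card_prod, Fintype.card_fin, ZMod.card]
  rw [← hcard]
  refine comp_le (by linarith) hγ
    (fun q => ∑ h ∈ A with lev h = q.1,
      ((p : ℂ)⁻¹ * ZMod.stdAddChar (-(q.2 * residue (zs q.1) h))) • monomial h)
    (fun q => pointEval hα hγ (latticePoint (zs q.1) q.2))
    (fun q => pointEval_mem_std hα hγ _) fun f hf => ?_
  have halg : ∑ q : Fin (L + 1) × ZMod p, pointEval hα hγ (latticePoint (zs q.1) q.2) f •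
      ∑ h ∈ A with lev h = q.1,
        ((p : ℂ)⁻¹ * ZMod.stdAddChar (-(q.2 * residue (zs q.1) h))) • (monomial h : L2 d) =
      trigPoly A fun h => latticeCoeff hα hγ (zs (lev h)) h f := by
    rw [trigPoly, Fintype.sum_prod_type, ← Finset.sum_fiberwise A lev]
    refine Finset.sum_congr rfl fun l _ => ?_
    simp only [Finset.smul_sum, smul_smul]
    rw [Finset.sum_comm]
    refine Finset.sum_congr rfl fun h hh => ?_
    rw [(Finset.mem_filter.1 hh).2, latticeCoeff, Finset.sum_smul]
  rw [halg]
  refine (pow_le_pow_iff_left₀ (norm_nonneg _) hε two_ne_zero).1 ?_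
  refine (norm_sub_trigPoly_sq_le _ hγ hM0 f _).trans ?_
  rw [← hA, ← Finset.sum_fiberwise A lev]
  have hlevel : ∀ l ∈ (Finset.univ : Finset (Fin (L + 1))), ∑ h ∈ A with lev h = l,
      ‖coeff (f : L2 d) h - latticeCoeff hα hγ (zs (lev h)) h f‖ ^ 2 ≤ M⁻¹ * normH f ^ 2 :=
    fun l _ => by
      refine le_trans (le_of_eq ?_) (sum_norm_latticeCoeff_sub_sq_le hα hγ (zs l) hM0
        (A.filter fun h => lev h = l) (fun h hh => mem_lowFreq.1 (Finset.mem_filter.1 hh).1)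
        (fun h hh => ?_) f)
      · exact Finset.sum_congr rfl fun h hh => by rw [(Finset.mem_filter.1 hh).2]
      · rw [← (Finset.mem_filter.1 hh).2]
        exact hlev h (Finset.mem_filter.1 hh).1
  have h1 := Finset.sum_le_card_nsmul _ _ _ hlevel
  rw [Finset.card_univ, Fintype.card_fin, nsmul_eq_mul] at h1
  push_cast at h1
  have h2 : M⁻¹ * normH f ^ 2 ≤ M⁻¹ :=
    mul_le_of_le_one_right (inv_pos.2 hM0).le (pow_le_one₀ (normH_nonneg f) hf)
  have h3 : ((L : ℝ) + 1) * (M⁻¹ * normH f ^ 2) ≤ (L + 1) * M⁻¹ := by gcongr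
  rw [div_eq_mul_inv] at hLM
  linarith

/-- Logarithms are absorbed by `log y ≤ y^η / η`. The constant `K = 12 + 4/η` is chosen to close on
itself: `log K ≤ K/4 + 1` and `1/η = (K - 12)/4` lead to `L + 2 ≤ K/2 + 4 + (K/2 - 4) y^η`. -/
theorem two_add_le_mul_rpow {η y : ℝ} (hη : 0 < η) (hy : 1 ≤ y) {L : ℕ}
    (hL : (2 : ℝ) ^ L ≤ (12 + 4 / η) * y ^ (1 + η)) : (L : ℝ) + 2 ≤ (12 + 4 / η) * y ^ η := by
  set K : ℝ := 12 + 4 / η with hK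
  have hη' : 0 < 4 / η := by positivity
  have hK0 : 0 < K := by positivity
  have hy0 : 0 < y := by linarith
  have hyη := Real.one_le_rpow hy hη.le
  have h1 := Real.log_le_log (by positivity) hL
  rw [Real.log_pow, Real.log_mul hK0.ne' (by positivity), Real.log_rpow hy0] at h1
  have h2 : Real.log K ≤ K / 4 + 1 := by
    have h3 : Real.log K = Real.log (K / 4) + Real.log 2 + Real.log 2 := by
      rw [← Real.log_mul (by positivity) two_ne_zero, ← Real.log_mul (by positivity) two_ne_zero]
      congr 1
      ring
    have h4 := Real.log_le_sub_one_of_pos (show 0 < K / 4 by positivity)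
    have h5 := Real.log_two_lt_d9
    linarith
  have h3 := Real.log_le_rpow_div hy0.le hη
  have h4 := Real.log_two_gt_d9
  have h5 : (1 + η) * Real.log y ≤ (1 + η) * (y ^ η / η) := by gcongr
  have h6 : (1 + η) * (y ^ η / η) = (1 / η + 1) * y ^ η := by field_simp
  have h7 : (L : ℝ) ≤ 2 * (L * Real.log 2) := by
    have : (0 : ℝ) ≤ L := Nat.cast_nonneg L
    nlinarith
  have h8 : 1 / η = (K - 12) / 4 := by rw [hK]; ring
  rw [h6, h8] at h5
  nlinarith

/-- The information complexity of function values is at most of the order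
`(ε⁻² ∑_h 1 / r(h))^{1 + 2η}`, uniformly in all parameters. -/
theorem exists_comp_std_le {η : ℝ} (hη : 0 < η) : ∃ C : ℝ, 0 < C ∧
    ∀ (α : ℝ) (γ : ℕ → ℝ), 1 < α → (∀ j, 0 < γ j ∧ γ j ≤ 1) → ∀ (ε : ℝ), 0 < ε → ε < 1 → ∀ d : ℕ,
      ∃ N : ℕ, comp (LambdaStd α γ) ε d ≤ N ∧
        (N : ℝ) ≤ C * (ε ^ (-2 : ℝ) * ∏ j : Fin d, (1 + 2 * γ j * zetaSum α)) ^ (1 + 2 * η) := by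
  have hη' : 0 < 4 / η := by positivity
  obtain ⟨K, hK⟩ : ∃ K : ℝ, K = 12 + 4 / η := ⟨_, rfl⟩
  have hK1 : 1 ≤ K := by linarith
  refine ⟨14 * K ^ 2, by positivity, fun α γ hα hγ ε hε0 hε1 d => ?_⟩
  have hT := one_le_prod_zeta hα hγ d
  obtain ⟨T, hTdef⟩ : ∃ T, T = ∏ j : Fin d, (1 + 2 * γ j * zetaSum α) := ⟨_, rfl⟩
  have hcardle := fun M hM => card_lowFreq_le (d := d) (zero_lt_one.trans hα) hγ (s := 1)
    (by linarith) (M := M) hM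
  have hcomp := fun M (hM : 1 ≤ M) (p L : ℕ) (hp : Fact p.Prime) =>
    comp_std_le (d := d) hα hγ hM hε0.le (p := p) (L := L)
  simp only [Real.rpow_one, mul_one] at hcardle
  rw [← hTdef] at hT hcardle hcomp ⊢
  have he1 : 1 ≤ ε ^ (-2 : ℝ) := (Real.one_lt_rpow_of_pos_of_lt_one_of_neg hε0 hε1 (by norm_num)).le
  set y := ε ^ (-2 : ℝ) * T with hy
  have hy1 : 1 ≤ y := one_le_mul_of_one_le_of_one_le he1 hT
  have hy0 : 0 < y := by linarith
  have hyη := Real.one_le_rpow hy1 hη.le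
  -- The factor `K y^η` over `ε⁻²` pays for the number of lattices, which is logarithmic in `M T`.
  set M := K * ε ^ (-2 : ℝ) * y ^ η with hMdef
  have hM1 : 1 ≤ M :=
    one_le_mul_of_one_le_of_one_le (one_le_mul_of_one_le_of_one_le hK1 he1) hyη
  have hM0 : 0 < M := by linarith
  have hMT : M * T = K * y ^ (1 + η) := by
    rw [hMdef, Real.rpow_add hy0, Real.rpow_one, hy]
    ring
  set A := (lowFreq (zero_lt_one.trans hα) hγ d M).card with hA
  have hAMT : (A : ℝ) ≤ K * y ^ (1 + η) := (hcardle M hM0).trans_eq hMT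
  have hy1η := Real.one_le_rpow hy1 (show 0 ≤ 1 + η by linarith)
  have hpow : (2 : ℝ) ^ Nat.log 2 A ≤ K * y ^ (1 + η) := by
    by_cases hA0 : A = 0
    · rw [hA0, Nat.log_zero_right, pow_zero]
      exact one_le_mul_of_one_le_of_one_le hK1 hy1η
    · refine le_trans ?_ hAMT
      exact_mod_cast Nat.pow_log_le_self 2 hA0
  have hL := two_add_le_mul_rpow hη hy1 (L := Nat.log 2 A) (by rwa [← hK])
  rw [← hK] at hL
  set n := ⌈6 * M * T⌉₊ with hn
  have hMT1 : 1 ≤ M * T := one_le_mul_of_one_le_of_one_le hM1 hT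
  have hn0 : n ≠ 0 := (Nat.ceil_pos.2 (by linarith)).ne'
  -- Bertrand's postulate: `p ≤ 2n ≤ 2 (6MT + 1) ≤ 14MT`, the source of the constant 14.
  obtain ⟨p, hp, hnp, hpn⟩ := Nat.exists_prime_lt_and_le_two_mul n hn0
  have hpn' : (p : ℝ) ≤ 14 * (M * T) := by
    have h1 : (p : ℝ) ≤ 2 * n := by exact_mod_cast hpn
    have h2 := Nat.ceil_lt_add_one (show 0 ≤ 6 * M * T by linarith)
    rw [← hn] at h2
    linarith
  refine ⟨(Nat.log 2 A + 1) * p, hcomp M hM1 p _ ⟨hp⟩ ?_ (Nat.lt_pow_succ_log_self one_lt_two A) ?_, ?_⟩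
  · refine (Nat.le_ceil _).trans ?_
    exact_mod_cast hnp.le
  · rw [div_le_iff₀ hM0]
    refine hL.trans_eq ?_
    have : ε ^ 2 * ε ^ (-2 : ℝ) = 1 := by
      rw [Real.rpow_neg hε0.le, Real.rpow_two, mul_inv_cancel₀ (by positivity)]
    rw [hMdef]
    linear_combination (-(K * y ^ η)) * this
  · push_cast
    have h1 : (Nat.log 2 A : ℝ) + 1 ≤ K * y ^ η := by linarith
    have h2 : y ^ (1 + 2 * η) = y ^ η * y ^ (1 + η) := by
      rw [← Real.rpow_add hy0]
      congr 1
      ring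
    rw [hMT] at hpn'
    calc ((Nat.log 2 A : ℝ) + 1) * p ≤ (K * y ^ η) * (14 * (K * y ^ (1 + η))) := by gcongr
      _ = _ := by rw [h2]; ring

/-! ### Strong tractability for function values -/

theorem compBound_std_of_summable (hα : 1 < α) (hγ : ∀ j, 0 < γ j ∧ γ j ≤ 1) (hs : Summable γ)
    {η : ℝ} (hη : 0 < η) :
    ∃ C : ℝ, 0 ≤ C ∧ CompBound (LambdaStd α γ) C (2 + 4 * η) 0 := by
  obtain ⟨C, hC, hb⟩ := exists_comp_std_le hη
  have hZ : 0 ≤ zetaSum α := zero_le_one.trans (one_le_zetaSum hα)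
  refine ⟨C * Real.exp (2 * zetaSum α * ∑' j, γ j) ^ (1 + 2 * η), by positivity,
    compBound_of_forall fun ε h0 h1 d hd => ?_⟩
  obtain ⟨N, hN, hNle⟩ := hb α γ hα hγ ε h0 h1 d
  refine ⟨N, hN, hNle.trans ?_⟩
  have hT0 := zero_le_one.trans (one_le_prod_zeta hα hγ d)
  have hT : ∏ j : Fin d, (1 + 2 * γ j * zetaSum α) ≤ Real.exp (2 * zetaSum α * ∑' j, γ j) := by
    refine (prod_le_exp_sum hZ γ (fun j => (hγ j).1.le) d).trans ?_
    gcongr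
    exact hs.sum_le_tsum _ fun j _ => (hγ j).1.le
  have he : ε ^ (-(2 + 4 * η)) = (ε ^ (-2 : ℝ)) ^ (1 + 2 * η) := by
    rw [← Real.rpow_mul h0.le]
    congr 1
    ring
  rw [Real.rpow_zero, mul_one, he, Real.mul_rpow (by positivity) hT0]
  have h2 := Real.rpow_le_rpow hT0 hT (show 0 ≤ 1 + 2 * η by linarith)
  have h3 : 0 < (ε ^ (-2 : ℝ)) ^ (1 + 2 * η) := by positivity
  calc C * ((ε ^ (-2 : ℝ)) ^ (1 + 2 * η) * (∏ j : Fin d, (1 + 2 * γ j * zetaSum α)) ^ (1 + 2 * η))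
      ≤ C * ((ε ^ (-2 : ℝ)) ^ (1 + 2 * η) *
        Real.exp (2 * zetaSum α * ∑' j, γ j) ^ (1 + 2 * η)) := by gcongr
    _ = _ := by ring

theorem exponent_std_le_two (hα : 1 < α) (hγ : ∀ j, 0 < γ j ∧ γ j ≤ 1) (hs : Summable γ) :
    exponent (LambdaStd α γ) ≤ 2 := by
  refine ENNReal.le_of_forall_pos_le_add fun η hη _ => ?_
  obtain ⟨C, hC, hb⟩ := compBound_std_of_summable hα hγ hs (η := η / 4) (by positivity)
  have h1 : ((2 + η : ℝ≥0) : ℝ) = 2 + 4 * (η / 4 : ℝ) := by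
    push_cast
    ring
  have h2 : exponent (LambdaStd α γ) ≤ ((2 + η : ℝ≥0) : ℝ≥0∞) :=
    iInf₂_le (2 + η) ⟨C, hC, h1 ▸ hb⟩
  exact_mod_cast h2

theorem stronglyTractable_std_iff (hα : 1 < α) (hγ : ∀ j, 0 < γ j ∧ γ j ≤ 1) :
    StronglyTractable (LambdaStd α γ) ↔ Summable γ := by
  refine ⟨fun ⟨C, p, hC, hp, hb⟩ => ?_, fun hs => ?_⟩
  · refine summable_of_sum_range_le (c := 3 * Real.log (2 * (C * (1 / 2 : ℝ) ^ (-p) + 1)))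
      (fun j => (hγ j).1.le) fun d => ?_
    -- Passing to `d + 1` summands avoids dimension zero, where no complexity bound is assumed.
    refine (Finset.sum_le_sum_of_subset_of_nonneg (Finset.range_mono (Nat.le_succ d))
      fun j _ _ => (hγ j).1.le).trans ?_
    have h1 := hb.exp_sum_le hα hγ hC (Nat.succ_pos d)
    rw [Real.rpow_zero, mul_one, ← Real.le_log_iff_exp_le (by positivity)] at h1
    linarith
  · obtain ⟨C, hC, hb⟩ := compBound_std_of_summable hα hγ hs one_pos
    exact ⟨C, _, hC, by norm_num, hb⟩

/-! ### Tractability for function values -/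

theorem logRatio_lt_top_of_tractable (hα : 1 < α) (hγ : ∀ j, 0 < γ j ∧ γ j ≤ 1)
    (h : Tractable (LambdaStd α γ)) : logRatio γ < ⊤ := by
  obtain ⟨C, p, q, hC, hp, hq, hb⟩ := h
  set K : ℝ := 2 * (C * (1 / 2 : ℝ) ^ (-p) + 1) with hK
  have hK1 : 1 ≤ K := by
    have : 0 ≤ C * (1 / 2 : ℝ) ^ (-p) := by positivity
    linarith
  refine lt_of_le_of_lt (limsup_le_of_le (a := ENNReal.ofReal (3 * (Real.log K + q))) ?_ ?_)
    ENNReal.ofReal_lt_top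
  · isBoundedDefault
  -- From `d = 3` on `log d ≥ 1`, so the constant `log K` is absorbed into `log K * log d`.
  filter_upwards [eventually_ge_atTop 3] with d hd
  refine ENNReal.ofReal_le_ofReal ?_
  have hd3 : (3 : ℝ) ≤ d := by exact_mod_cast hd
  have hd0 : (0 : ℝ) < d := by linarith
  have hlog : 1 ≤ Real.log d := by
    rw [Real.le_log_iff_exp_le hd0]
    have := Real.exp_one_lt_d9
    linarith
  have h1 := hb.exp_sum_le hα hγ hC (show 1 ≤ d by omega)
  have hdq : 1 ≤ (d : ℝ) ^ q := Real.one_le_rpow (by linarith) hq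
  have h2 : 2 * (C * (1 / 2 : ℝ) ^ (-p) * (d : ℝ) ^ q + 1) ≤ K * (d : ℝ) ^ q := by
    rw [hK]
    linarith
  have h3 := (Real.le_log_iff_exp_le (by positivity)).2 (h1.trans h2)
  rw [Real.log_mul (by positivity) (by positivity), Real.log_rpow hd0] at h3
  rw [div_le_iff₀ (by linarith)]
  have h4 : Real.log K * 1 ≤ Real.log K * Real.log d :=
    mul_le_mul_of_nonneg_left hlog (Real.log_nonneg hK1)
  linarith

theorem prod_zeta_le_rpow (hα : 1 < α) (hγ : ∀ j, 0 < γ j ∧ γ j ≤ 1) (ha : logRatio γ < ⊤)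
    {η : ℝ} (hη : 0 < η) : ∃ C : ℝ, 0 < C ∧ ∀ d : ℕ, 1 ≤ d →
      ∏ j : Fin d, (1 + 2 * γ j * zetaSum α) ≤
        C * (d : ℝ) ^ (2 * zetaSum α * ((logRatio γ).toReal + η)) := by
  have hZ : 0 ≤ zetaSum α := zero_le_one.trans (one_le_zetaSum hα)
  set b := (logRatio γ).toReal + η with hb
  have hb0 : 0 < b := by positivity
  have hlt : logRatio γ < ENNReal.ofReal b := by
    rw [hb, ENNReal.lt_ofReal_iff_toReal_lt ha.ne]
    linarith
  -- Beyond `d₀` the sums are below `b log d`; the finitely many smaller dimensions go into the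
  -- constant, and `D ≥ 2` keeps the logarithm positive.
  obtain ⟨d₀, hd₀⟩ := eventually_atTop.1 (eventually_lt_of_limsup_lt hlt)
  set D := max d₀ 2 with hD
  refine ⟨Real.exp (2 * zetaSum α * ∑ j ∈ Finset.range D, γ j), Real.exp_pos _, fun d hd => ?_⟩
  refine (prod_le_exp_sum hZ γ (fun j => (hγ j).1.le) d).trans ?_
  have hd1 : (1 : ℝ) ≤ d := by exact_mod_cast hd
  have hsum0 : 0 ≤ ∑ j ∈ Finset.range D, γ j := Finset.sum_nonneg fun j _ => (hγ j).1.le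
  rcases le_total d D with h | h
  · refine le_trans ?_ (le_mul_of_one_le_right (Real.exp_pos _).le
      (Real.one_le_rpow hd1 (by positivity)))
    gcongr
    exact fun j _ _ => (hγ j).1.le
  · have hd2 : 2 ≤ d := (le_max_right _ _).trans h
    have hlog : 0 < Real.log d := Real.log_pos (by exact_mod_cast hd2)
    have h1 := hd₀ d ((le_max_left _ _).trans h)
    rw [ENNReal.ofReal_lt_ofReal_iff hb0, div_lt_iff₀ hlog] at h1
    refine le_trans ?_ (le_mul_of_one_le_left (by positivity) (Real.one_le_exp (by positivity)))
    rw [Real.rpow_def_of_pos (by linarith), Real.exp_le_exp]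
    calc 2 * zetaSum α * ∑ j ∈ Finset.range d, γ j ≤ 2 * zetaSum α * (b * Real.log d) := by gcongr
      _ = _ := by ring

theorem compBound_std_of_logRatio (hα : 1 < α) (hγ : ∀ j, 0 < γ j ∧ γ j ≤ 1)
    (ha : logRatio γ < ⊤) {δ : ℝ} (hδ : 0 < δ) : ∃ C : ℝ, 0 < C ∧
      CompBound (LambdaStd α γ) C (2 + δ)
        (4 * (riemannZeta (α : ℂ)).re * (logRatio γ).toReal + δ) := by
  rw [← zetaSum_eq_riemannZeta hα]
  have hZ : 0 < zetaSum α := zero_lt_one.trans_le (one_le_zetaSum hα)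
  set a := (logRatio γ).toReal with hadef
  have ha0 : 0 ≤ a := ENNReal.toReal_nonneg
  -- `4η ≤ δ` controls the power `2 + 4η` of `1/ε`, and `2η ≤ 1` at most doubles the exponent
  -- `2ζ(α)a + δ/2` of `d`.
  set η := min (δ / 4) (1 / 2) with hηdef
  have hη : 0 < η := by positivity
  have hη1 : 4 * η ≤ δ := by linarith [min_le_left (δ / 4) (1 / 2 : ℝ)]
  have hη2 : 2 * η ≤ 1 := by linarith [min_le_right (δ / 4) (1 / 2 : ℝ)]
  obtain ⟨C, hC, hb⟩ := exists_comp_std_le hη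
  obtain ⟨K, hK, hT⟩ := prod_zeta_le_rpow hα hγ ha (η := δ / (4 * zetaSum α)) (by positivity)
  refine ⟨C * K ^ (1 + 2 * η), by positivity, compBound_of_forall fun ε h0 h1 d hd => ?_⟩
  obtain ⟨N, hN, hNle⟩ := hb α γ hα hγ ε h0 h1 d
  refine ⟨N, hN, hNle.trans ?_⟩
  have hd1 : (1 : ℝ) ≤ d := by exact_mod_cast hd
  have hT0 := zero_le_one.trans (one_le_prod_zeta hα hγ d)
  rw [Real.mul_rpow (by positivity) hT0, ← Real.rpow_mul h0.le]
  have h2 := Real.rpow_le_rpow hT0 (hT d hd) (show 0 ≤ 1 + 2 * η by linarith)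
  rw [Real.mul_rpow hK.le (by positivity), ← Real.rpow_mul (by positivity)] at h2
  have h3 : ε ^ (-2 * (1 + 2 * η)) ≤ ε ^ (-(2 + δ)) :=
    Real.rpow_le_rpow_of_exponent_ge h0 h1.le (by linarith)
  have h4 : (d : ℝ) ^ (2 * zetaSum α * (a + δ / (4 * zetaSum α)) * (1 + 2 * η)) ≤
      (d : ℝ) ^ (4 * zetaSum α * a + δ) := by
    refine Real.rpow_le_rpow_of_exponent_le hd1 ?_
    have h5 : 2 * zetaSum α * (a + δ / (4 * zetaSum α)) = 2 * zetaSum α * a + δ / 2 := by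
      field_simp
      ring
    rw [h5]
    have h6 : 0 ≤ 2 * zetaSum α * a + δ / 2 := by positivity
    nlinarith
  calc _ ≤ C * (ε ^ (-(2 + δ)) * (K ^ (1 + 2 * η) * (d : ℝ) ^ (4 * zetaSum α * a + δ))) := by
        refine mul_le_mul_of_nonneg_left (mul_le_mul h3 (h2.trans ?_) (by positivity)
          (by positivity)) hC.le
        gcongr
    _ = _ := by ring

theorem tractable_std_iff (hα : 1 < α) (hγ : ∀ j, 0 < γ j ∧ γ j ≤ 1) :
    Tractable (LambdaStd α γ) ↔ logRatio γ < ⊤ := by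
  refine ⟨logRatio_lt_top_of_tractable hα hγ, fun ha => ?_⟩
  obtain ⟨C, hC, hb⟩ := compBound_std_of_logRatio hα hγ ha one_pos
  have hZ := one_le_zetaSum hα
  rw [zetaSum_eq_riemannZeta hα] at hZ
  exact ⟨C, _, _, hC.le, by norm_num, by positivity, hb⟩

end Korobov

end

theorem theorem1 (α : ℝ) (hα : 0 ≤ α) (γ : ℕ → ℝ) (hγ_pos : ∀ j, 0 < γ j)
    (hγ_anti : Antitone γ) (hγ_le : γ 0 ≤ 1) :
    -- Part 1: arbitrary continuous linear functionals, `α ≥ 0`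
    ((Korobov.StronglyTractable (Korobov.LambdaAll α γ) ↔
        Korobov.Tractable (Korobov.LambdaAll α γ)) ∧
      (Korobov.StronglyTractable (Korobov.LambdaAll α γ) ↔
        Korobov.sumExponent γ < ⊤ ∧ 0 < α) ∧
      (Korobov.StronglyTractable (Korobov.LambdaAll α γ) →
        Korobov.exponent (Korobov.LambdaAll α γ) =
          2 * max (Korobov.sumExponent γ) (ENNReal.ofReal α⁻¹))) ∧
    -- Part 2: strong tractability for function values, `α > 1`
    (1 < α →
      (Korobov.StronglyTractable (Korobov.LambdaStd α γ) ↔ Summable γ) ∧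
      (Summable γ →
        Korobov.exponent (Korobov.LambdaAll α γ) ≤ 2 ∧
        Korobov.exponent (Korobov.LambdaStd α γ) ∈
          Set.Icc (Korobov.exponent (Korobov.LambdaAll α γ))
            (Korobov.exponent (Korobov.LambdaAll α γ) + 2))) ∧
    -- Part 3: tractability for function values, `α > 1`
    (1 < α →
      (Korobov.Tractable (Korobov.LambdaStd α γ) ↔ Korobov.logRatio γ < ⊤) ∧
      (Korobov.logRatio γ < ⊤ →
        ∀ δ : ℝ, 0 < δ → ∃ C : ℝ, 0 < C ∧
          Korobov.CompBound (Korobov.LambdaStd α γ) C (2 + δ)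
            (4 * (riemannZeta (α : ℂ)).re * (Korobov.logRatio γ).toReal + δ))) := by
  have hγ : ∀ j, 0 < γ j ∧ γ j ≤ 1 := fun j => ⟨hγ_pos j, (hγ_anti (Nat.zero_le j)).trans hγ_le⟩
  have hnec := fun h => Korobov.Tractable.sumExponent_lt_top (Λ := Korobov.LambdaAll α γ) hα hγ
    hγ_anti h
  have hsuf := fun h : Korobov.sumExponent γ < ⊤ ∧ 0 < α =>
    Korobov.stronglyTractable_all h.2 hγ h.1
  refine ⟨⟨⟨fun h => h.tractable, fun h => hsuf (hnec h)⟩, ⟨fun h => hnec h.tractable, hsuf⟩,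
    fun h => le_antisymm (Korobov.exponent_all_le (hnec h.tractable).2 hγ)
      (Korobov.le_exponent hα hγ hγ_anti _)⟩, fun hα1 => ?_, fun hα1 => ?_⟩
  · refine ⟨Korobov.stronglyTractable_std_iff hα1 hγ, fun hs => ?_⟩
    have h1 := Korobov.exponent_all_le_exponent_std hα1 hγ
    have h2 := Korobov.exponent_std_le_two hα1 hγ hs
    -- The exponent for function values is itself at most 2, so the upper end of the interval is
    -- immediate.
    exact ⟨h1.trans h2, h1, h2.trans le_add_self⟩
  · exact ⟨Korobov.tractable_std_iff hα1 hγ, fun ha δ hδ =>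
      Korobov.compBound_std_of_logRatio hα1 hγ ha hδ⟩
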